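/- Let $N\ge 2$. For $i=1,\dots,N$ let $\dot x_i=A_ix_i+B_iu_i$, $y_i=C_ix_i$ with $x_i\in\mathbb R^{n_i}$, $u_i,y_i\in\mathbb R$ be a linear agent such that the triple $(C_i,A_i,B_i)$ is minimal (controllable and observable) and has no transmission zero at the origin, i.e. $\begin{bmatrix}A_i&B_i\\C_i&0\end{bmatrix}$ has rank $n_i+1$. Let $f_i:\mathbb R\to\mathbb R$ be twice continuously differentiable with $\underline h_i\le f_i''(s)\le\bar h_i$ for all $s\in\mathbb R$, where $0<\underline h_i\le\bar h_i$ are constants; put $\underline h=\min_i\underline h_i$, $\bar h=\max_i\bar h_i$, and let $y^*$ be the minimizer of $\sum_{i=1}^Nf_i$. Let $\mathcal G$ be a strongly connected and weight-balanced digraph on $\{1,\dots,N\}$ with weights $a_{ij}\ge0$ ($a_{ij}>0$ if and only if there is an edge from $j$ to $i$) and Laplacian $L$, and let $0=\lambda_1<\lambda_2\le\dots\le\lambda_N$ be the eigenvalues of $\frac12(L+L^\top)$. For each $i$ choose $K_{i1}$ such that $\hat A_i=A_i+B_iK_{i1}$ is Hurwitz, let $(X_i,U_i)$ be the solution of $0=A_iX_i+B_iU_i$,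 $1=C_iX_i$, put $K_{i2}=U_i-K_{i1}X_i$, let $P_i$ be the positive definite matrix with $\hat A_i^\top P_i+P_i\hat A_i=-2I_{n_i}$, and let $\lambda_{P_i}$ be the largest eigenvalue of $P_i$. Let $\eta>0$, $$\alpha\ge\max\Big\{1,\frac{2\eta}{\min\{\underline h,\lambda_2\}},\frac{6\bar h^2}{\underline h\lambda_2}\Big\},\qquad \beta\ge\max\Big\{1,\frac{7\alpha^2\lambda_N^2}{\lambda_2^2}\Big\},$$ and $0<\gamma<\min\{1,\frac1{2\lambda_{P_i}},\eta\}$ for every $i$. For $c_0,c_1\ge0$ with $c_0+c_1>0$ consider the closed loop of the agents with $$u_i(t)=K_{i1}x_i(t^i_k)+K_{i2}z_i(t^i_k)\quad\text{for } t\in[t^i_k,t^i_{k+1}),$$ $$\dot z_i=-\alpha f_i'(z_i)-\beta\sum_ja_{ij}(z_i-z_j)-\sum_ja_{ij}(v_i-v_j),\qquad \dot v_i=\alpha\beta\sum_ja_{ij}(z_i-z_j),$$ where $t^i_0=0$ and $$t^i_{k+1}=\inf\{t>t^i_k:\ |K_{i1}x_i(t^i_k)+K_{i2}z_i(t^i_k)-K_{i1}x_i(t)-K_{i2}z_i(t)|\ge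 c_0+c_1e^{-\gamma t}\},$$ with $t^i_{k+1}=\infty$ if there is no such $t$. Then there are constants $\kappa>0$ and $\mu>0$, independent of $c_0$, $c_1$ and the initial conditions, such that along every trajectory of the closed loop: a) there is $\tau>0$ such that $t^i_{k+1}-t^i_k>\tau$ for all $i$ and all $k\ge0$ with $t^i_k<\infty$ (in particular there is no Zeno behavior); b) for every $i$, the distance from $y_i(t)$ to the interval $[y^*-\kappa c_0,\,y^*+\kappa c_0]$ tends to $0$ as $t\to\infty$; c) if $c_0=0$, there is $M$ such that $|y_i(t)-y^*|\le Me^{-\mu t}$ for all $i$ and all $t\ge0$. -/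

import Mathlib

open scoped Matrix ENNReal Topology
open Set Filter

/-! ### Linear agents -/

/-- A single-input single-output linear system `ẋ = A x + B u`, `y = C x` with state space `ℝⁿ`. -/
structure LinSys (n : ℕ) where
  A : Matrix (Fin n) (Fin n) ℝ
  B : Fin n → ℝ
  C : Fin n → ℝ

namespace LinSys

variable {n : ℕ}

/-- Kalman's condition: `[B, A B, …, Aⁿ⁻¹ B]` has full rank. -/
def IsControllable (S : LinSys n) : Prop :=
  (Matrix.of fun (j k : Fin n) => ((S.A ^ (k : ℕ)) *ᵥ S.B) j).rank = n

/-- Kalman's condition: the matrix with rows `C, C A, …, C Aⁿ⁻¹` has full rank. -/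
def IsObservable (S : LinSys n) : Prop :=
  (Matrix.of fun (k j : Fin n) => (S.C ᵥ* (S.A ^ (k : ℕ))) j).rank = n

/-- Minimality of the triple `(C, A, B)`. -/
def IsMinimal (S : LinSys n) : Prop :=
  S.IsControllable ∧ S.IsObservable

/-- No transmission zero at the origin: the system matrix `[A - s I, B; C, 0]` has full rank
`n + 1` at `s = 0`. -/
def NoTransmissionZeroAtOrigin (S : LinSys n) : Prop :=
  (Matrix.fromBlocks S.A (Matrix.replicateCol Unit S.B) (Matrix.replicateRow Unit S.C)
    (0 : Matrix Unit Unit ℝ)).rank = n + 1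

/-- The closed-loop matrix `A + B K` for a feedback row `K`. -/
def closedLoop (S : LinSys n) (K : Fin n → ℝ) : Matrix (Fin n) (Fin n) ℝ :=
  S.A + Matrix.vecMulVec S.B K

end LinSys

/-- A real square matrix is Hurwitz: all its complex eigenvalues have negative real part. -/
def IsHurwitz {n : ℕ} (M : Matrix (Fin n) (Fin n) ℝ) : Prop :=
  ∀ μ ∈ spectrum ℂ (M.map (fun r : ℝ => (r : ℂ))), μ.re < 0

/-- The largest (real) eigenvalue of a real symmetric matrix. -/
noncomputable def maxEigenvalue {n : ℕ} (P : Matrix (Fin n) (Fin n) ℝ) : ℝ :=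
  sSup (spectrum ℝ P)

/-- The data of the tracking controller of one agent: `K₁` makes `A + B K₁` Hurwitz, `(X, U)` solves
the regulator equations `0 = A X + B U`, `1 = C X`, and `P` is positive definite and solves the
Lyapunov equation `(A + B K₁)ᵀ P + P (A + B K₁) = -2 I`. -/
structure IsTrackingDesign {n : ℕ} (S : LinSys n) (K₁ X : Fin n → ℝ) (U : ℝ)
    (P : Matrix (Fin n) (Fin n) ℝ) : Prop where
  hurwitz : IsHurwitz (S.closedLoop K₁)
  regulator_state : S.A *ᵥ X + U • S.B = 0
  regulator_output : S.C ⬝ᵥ X = 1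
  posDef : P.PosDef
  lyapunov : (S.closedLoop K₁)ᵀ * P + P * S.closedLoop K₁ = (-2 : ℝ) • 1

/-! ### Weighted digraphs, given by the adjacency matrix `a`

The entry `a i j` is positive if there is a directed edge from `j` to `i`, and is `0` otherwise. -/

section Graph

variable {N : ℕ}

/-- Every node can be reached from every other node along directed edges. -/
def IsStronglyConnected (a : Matrix (Fin N) (Fin N) ℝ) : Prop :=
  ∀ p q, Relation.ReflTransGen (fun j i => 0 < a i j) p q

/-- At every node, the in-degree equals the out-degree. -/
def IsWeightBalanced (a : Matrix (Fin N) (Fin N) ℝ) : Prop :=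
  ∀ i, ∑ j, a i j = ∑ j, a j i

/-- The Laplacian of the digraph. -/
def laplacian (a : Matrix (Fin N) (Fin N) ℝ) : Matrix (Fin N) (Fin N) ℝ :=
  Matrix.diagonal (fun i => ∑ j, a i j) - a

/-- `Sym(L) = (L + Lᵀ) / 2`. -/
noncomputable def symLaplacian (a : Matrix (Fin N) (Fin N) ℝ) : Matrix (Fin N) (Fin N) ℝ :=
  (1 / 2 : ℝ) • (laplacian a + (laplacian a)ᵀ)

theorem symLaplacian_isHermitian (a : Matrix (Fin N) (Fin N) ℝ) :
    (symLaplacian a).IsHermitian := by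
  unfold Matrix.IsHermitian symLaplacian
  rw [Matrix.conjTranspose_eq_transpose_of_trivial, Matrix.transpose_smul, Matrix.transpose_add,
    Matrix.transpose_transpose, add_comm]

/-- The eigenvalues of `Sym(L)`, counted with multiplicity, in increasing order
(`eigenvalues₀` lists them in decreasing order); the index `0` is the smallest one. -/
noncomputable def symLaplacianEigenvalue (a : Matrix (Fin N) (Fin N) ℝ) (k : Fin N) : ℝ :=
  (symLaplacian_isHermitian a).eigenvalues₀ (Fin.cast (Fintype.card_fin N).symm k.rev)

/-- `λ₂`, the second smallest eigenvalue of `Sym(L)`. -/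
noncomputable def lambdaTwo (hN : 2 ≤ N) (a : Matrix (Fin N) (Fin N) ℝ) : ℝ :=
  symLaplacianEigenvalue a ⟨1, by omega⟩

/-- `λ_N`, the largest eigenvalue of `Sym(L)`. -/
noncomputable def lambdaMax (hN : 2 ≤ N) (a : Matrix (Fin N) (Fin N) ℝ) : ℝ :=
  symLaplacianEigenvalue a ⟨N - 1, by omega⟩

end Graph

/-! ### The event-triggered closed loop -/

/-- The continuously updated input `K₁ x(s) + K₂ z(s)`. -/
def idealInput {n : ℕ} (K₁ : Fin n → ℝ) (K₂ : ℝ) (x : ℝ → Fin n → ℝ) (z : ℝ → ℝ) (s : ℝ) : ℝ :=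
  K₁ ⬝ᵥ x s + K₂ * z s

/-- Trajectories of the agents `ẋᵢ = Aᵢ xᵢ + Bᵢ uᵢ` under the event-triggered controller

* `uᵢ(s) = K₁ᵢ xᵢ(tᵢₖ) + K₂ᵢ zᵢ(tᵢₖ)` for `tᵢₖ ≤ s < tᵢₖ₊₁`,
* `żᵢ = -α fᵢ'(zᵢ) - β ∑ⱼ aᵢⱼ (zᵢ - zⱼ) - ∑ⱼ aᵢⱼ (vᵢ - vⱼ)`, `v̇ᵢ = α β ∑ⱼ aᵢⱼ (zᵢ - zⱼ)`,
* `tᵢ₀ = 0`, `tᵢₖ₊₁ = inf {s > tᵢₖ | |uᵢ(s) - (K₁ᵢ xᵢ(s) + K₂ᵢ zᵢ(s))| ≥ c₀ + c₁ exp(-γ s)}`,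
  where `uᵢ` is the input that is held since `tᵢₖ`.

Event times take values in `[0, ∞]`, and `tᵢₖ₊₁ = ∞` means that no event follows `tᵢₖ`.
Accumulation of events is not excluded: the equation of agent `i` is only imposed before
`supₖ tᵢₖ`, and the values of `xᵢ` from then on are irrelevant. -/
structure IsTrajectory {N : ℕ} {n : Fin N → ℕ} (S : ∀ i, LinSys (n i))
    (K₁ : ∀ i, Fin (n i) → ℝ) (K₂ : Fin N → ℝ) (f : Fin N → ℝ → ℝ)
    (a : Matrix (Fin N) (Fin N) ℝ) (α β c₀ c₁ γ : ℝ)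
    (x : ∀ i, ℝ → Fin (n i) → ℝ) (z v : Fin N → ℝ → ℝ) (t : Fin N → ℕ → ℝ≥0∞) : Prop where
  z_deriv : ∀ i, ∀ s : ℝ, 0 ≤ s → HasDerivWithinAt (z i)
    (-α * deriv (f i) (z i s) - β * ∑ j, a i j * (z i s - z j s)
      - ∑ j, a i j * (v i s - v j s)) (Ici 0) s
  v_deriv : ∀ i, ∀ s : ℝ, 0 ≤ s → HasDerivWithinAt (v i)
    (α * β * ∑ j, a i j * (z i s - z j s)) (Ici 0) s
  t_zero : ∀ i, t i 0 = 0
  t_lt : ∀ i k, t i k ≠ ⊤ → t i k < t i (k + 1)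
  t_succ : ∀ i k, t i (k + 1) = sInf {s : ℝ≥0∞ | t i k < s ∧ s ≠ ⊤ ∧
    c₀ + c₁ * Real.exp (-γ * s.toReal) ≤
      |idealInput (K₁ i) (K₂ i) (x i) (z i) (t i k).toReal
        - idealInput (K₁ i) (K₂ i) (x i) (z i) s.toReal|}
  x_cont : ∀ i, ContinuousOn (x i) {s : ℝ | 0 ≤ s ∧ ∃ k, ENNReal.ofReal s < t i k}
  x_deriv : ∀ i k, ∀ s : ℝ, 0 ≤ s → t i k ≤ ENNReal.ofReal s → ENNReal.ofReal s < t i (k + 1) →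
    HasDerivWithinAt (x i)
      ((S i).A *ᵥ x i s + idealInput (K₁ i) (K₂ i) (x i) (z i) (t i k).toReal • (S i).B) (Ici s) s

/-! ### A comparison lemma for right derivatives -/

/-! The optimizer `(z, v)` receives no feedback from the agents, so the closed loop is a cascade: an
autonomous optimizer drives each event-triggered agent separately.

Optimizer. Take an equilibrium value `vs` of `v`, put `y = z - y*`, and let `q` be the deviation of
`v - vs + α y` from its mean. The shift by `α y` removes `β` from the equation of `q` and creates
the damping `-α L q`, which `λ₂` controls because `q` has zero sum. The function `|y|² + |q|² / α³`
then decays at rate `2η` (`optimizer_dissipation`), so `z - y*` and the velocity of `z` decay at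
rate `η` (`optimizer_convergence`). Since `L` need not be symmetric, `|L x|² ≤ 2 λ_N xᵀ L x`
replaces a spectral bound.

Agent. The regulator equations turn `ξ = x - z X` into a Hurwitz system driven by the input error
along `B` and by the velocity of `z` along `X`. The trigger keeps the first below the threshold, and
the second decays faster than `e^{-γ s}`. The Lyapunov function `ξᵀ P ξ` gives `|ξ| ≤ κ c₀ + M'
e^{-γ s}` (`exists_tracking_bound`), and the output error is `C x - z = C ξ`.

Zeno. Between events every term in the derivative of the ideal input is dominated by the threshold
at the last event, because all of them decay at rate `γ` down to a multiple of `c₀`. Reaching the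
threshold again therefore takes a time bounded below uniformly (`exists_agent_tracking`). There is
no circularity: the tracking bound holds up to a possible accumulation of events, with constants
independent of the horizon. -/

theorem le_add_exp_of_deriv_right_le {V V' : ℝ → ℝ} {b δ ρ D E : ℝ}
    (hV : ContinuousOn V (Icc 0 b))
    (hV' : ∀ s ∈ Ico 0 b, HasDerivWithinAt V (V' s) (Ici s) s)
    (hle : ∀ s ∈ Ico 0 b, V' s ≤ -δ * V s + δ * D + (δ - ρ) * E * Real.exp (-ρ * s))
    (h0 : V 0 ≤ D + E) : ∀ s ∈ Icc 0 b, V s ≤ D + E * Real.exp (-ρ * s) := by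
  intro s hs
  have hexp : ∀ (r u : ℝ), HasDerivAt (fun w => Real.exp (r * w)) (Real.exp (r * u) * r) u :=
    fun r u => by simpa using ((hasDerivAt_id u).const_mul r).exp
  -- `D + E exp(-ρ s)` solves the differential equation exactly; with the integrating factor `exp(δ
  -- s)`, the excess of `V` over it has nonpositive right derivative and starts nonpositive. No sign
  -- of `δ - ρ` or `E` is needed.
  have key := image_le_of_deriv_right_le_deriv_boundary
    (f := fun u => Real.exp (δ * u) * (V u - D - E * Real.exp (-ρ * u)))
    (f' := fun u => Real.exp (δ * u) * δ * (V u - D - E * Real.exp (-ρ * u))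
      + Real.exp (δ * u) * (V' u - E * (Real.exp (-ρ * u) * -ρ)))
    (a := 0) (b := b) (B := fun _ => 0) (B' := fun _ => 0) (by fun_prop)
    (fun u hu => by
      have := ((hexp δ u).hasDerivWithinAt (s := Ici u)).mul
        (((hV' u hu).sub_const D).sub (((hexp (-ρ) u).hasDerivWithinAt).const_mul E))
      exact this)
    (by simp; linarith) continuousOn_const (fun u _ => hasDerivWithinAt_const _ _ _)
    (fun u hu => by
      have h1 := hle u hu
      have h2 := Real.exp_pos (δ * u)
      have : δ * (V u - D - E * Real.exp (-ρ * u)) + (V' u - E * (Real.exp (-ρ * u) * -ρ)) ≤ 0 := by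
        linarith
      nlinarith) hs
  have h2 := Real.exp_pos (δ * s)
  by_contra! hc
  have : 0 < Real.exp (δ * s) * (V s - D - E * Real.exp (-ρ * s)) := mul_pos h2 (by linarith)
  linarith

/-! ### Young and Cauchy–Schwarz inequalities -/

theorem abs_le_add_of_sq_le {s u v : ℝ} (hu : 0 ≤ u) (hv : 0 ≤ v) (h : s ^ 2 ≤ 4 * (u * v)) :
    |s| ≤ u + v :=
  abs_le_of_sq_le_sq (by nlinarith [sq_nonneg (u - v)]) (by positivity)

theorem dotProduct_sq_le {ι : Type*} [Fintype ι] (x y : ι → ℝ) :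
    (x ⬝ᵥ y) ^ 2 ≤ (x ⬝ᵥ x) * (y ⬝ᵥ y) := by
  simpa [dotProduct, sq] using Finset.sum_mul_sq_le_sq_mul_sq Finset.univ x y

theorem dotProduct_self_nonneg' {ι : Type*} [Fintype ι] (x : ι → ℝ) : 0 ≤ x ⬝ᵥ x :=
  Finset.sum_nonneg fun i _ => mul_self_nonneg (x i)

/-! ### Quadratic forms of symmetric matrices -/

section Spectral

variable {m : Type*} [Fintype m] [DecidableEq m] {S : Matrix m m ℝ}

/-- The coordinate of `x` along the `k`-th eigenvector. -/
noncomputable def eigenCoord (hS : S.IsHermitian) (k : m) (x : m → ℝ) : ℝ :=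
  ⇑(hS.eigenvectorBasis k) ⬝ᵥ x

theorem sum_eigenCoord_mul (hS : S.IsHermitian) (x y : m → ℝ) :
    ∑ k, eigenCoord hS k x * eigenCoord hS k y = x ⬝ᵥ y := by
  have := hS.eigenvectorBasis.sum_inner_mul_inner (WithLp.toLp 2 x) (WithLp.toLp 2 y)
  simp only [EuclideanSpace.inner_eq_star_dotProduct, star_trivial] at this
  rw [dotProduct_comm x y, ← this]
  refine Finset.sum_congr rfl fun k _ => ?_
  simp only [eigenCoord]
  rw [dotProduct_comm y]

theorem eigenCoord_mulVec (hS : S.IsHermitian) (k : m) (x : m → ℝ) :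
    eigenCoord hS k (S *ᵥ x) = hS.eigenvalues k * eigenCoord hS k x := by
  have hT : Sᵀ = S := by rw [← Matrix.conjTranspose_eq_transpose_of_trivial]; exact hS
  unfold eigenCoord
  rw [Matrix.dotProduct_mulVec, ← Matrix.mulVec_transpose, hT, hS.mulVec_eigenvectorBasis,
    smul_dotProduct, smul_eq_mul]

theorem quadForm_eq_sum (hS : S.IsHermitian) (x : m → ℝ) :
    x ⬝ᵥ S *ᵥ x = ∑ k, hS.eigenvalues k * eigenCoord hS k x ^ 2 := by
  rw [← sum_eigenCoord_mul hS]
  refine Finset.sum_congr rfl fun k _ => ?_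
  rw [eigenCoord_mulVec]; ring

theorem dotProduct_self_eq_sum (hS : S.IsHermitian) (x : m → ℝ) :
    x ⬝ᵥ x = ∑ k, eigenCoord hS k x ^ 2 := by
  rw [← sum_eigenCoord_mul hS]
  refine Finset.sum_congr rfl fun k _ => ?_
  ring

theorem quadForm_le (hS : S.IsHermitian) {r : ℝ} (hr : ∀ k, hS.eigenvalues k ≤ r) (x : m → ℝ) :
    x ⬝ᵥ S *ᵥ x ≤ r * (x ⬝ᵥ x) := by
  rw [quadForm_eq_sum hS, dotProduct_self_eq_sum hS, Finset.mul_sum]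
  exact Finset.sum_le_sum fun k _ => mul_le_mul_of_nonneg_right (hr k) (sq_nonneg _)

/-- The alternative lets the bound ignore eigenvectors orthogonal to `x`; for Laplacians this
discards the eigenvalue zero on zero-sum vectors. -/
theorem le_quadForm (hS : S.IsHermitian) {r : ℝ} (x : m → ℝ)
    (hr : ∀ k, r ≤ hS.eigenvalues k ∨ eigenCoord hS k x = 0) :
    r * (x ⬝ᵥ x) ≤ x ⬝ᵥ S *ᵥ x := by
  rw [quadForm_eq_sum hS, dotProduct_self_eq_sum hS, Finset.mul_sum]
  refine Finset.sum_le_sum fun k _ => ?_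
  rcases hr k with h | h
  · exact mul_le_mul_of_nonneg_right h (sq_nonneg _)
  · simp [h]

theorem eigenvectorBasis_dotProduct_self (hS : S.IsHermitian) (k : m) :
    (⇑(hS.eigenvectorBasis k) : m → ℝ) ⬝ᵥ ⇑(hS.eigenvectorBasis k) = 1 := by
  have := hS.eigenvectorBasis.inner_eq_one k
  rwa [EuclideanSpace.inner_eq_star_dotProduct, star_trivial] at this

theorem eigenvectorBasis_dotProduct_ne (hS : S.IsHermitian) {k l : m} (h : k ≠ l) :
    (⇑(hS.eigenvectorBasis k) : m → ℝ) ⬝ᵥ ⇑(hS.eigenvectorBasis l) = 0 := by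
  have := hS.eigenvectorBasis.inner_eq_zero h.symm
  simpa [EuclideanSpace.inner_eq_star_dotProduct] using this

theorem eigenvalue_eq_quadForm (hS : S.IsHermitian) (k : m) :
    hS.eigenvalues k = (⇑(hS.eigenvectorBasis k) : m → ℝ) ⬝ᵥ S *ᵥ ⇑(hS.eigenvectorBasis k) := by
  rw [hS.mulVec_eigenvectorBasis, dotProduct_smul, eigenvectorBasis_dotProduct_self]; simp

end Spectral

/-! ### Laplacians of weight-balanced digraphs -/

section Laplacian

variable {N : ℕ} {a : Matrix (Fin N) (Fin N) ℝ}

theorem laplacian_mulVec (a : Matrix (Fin N) (Fin N) ℝ) (x : Fin N → ℝ) (i : Fin N) :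
    (laplacian a *ᵥ x) i = ∑ j, a i j * (x i - x j) := by
  simp only [laplacian, Matrix.sub_mulVec, Pi.sub_apply, Matrix.mulVec_diagonal, mul_sub,
    Finset.sum_sub_distrib, Finset.sum_mul]
  rfl

theorem IsWeightBalanced.transpose (h : IsWeightBalanced a) : IsWeightBalanced aᵀ :=
  fun i => (h i).symm

/-- Weight balance makes row and column sums of `a` agree, so reversing all edges leaves the
diagonal unchanged. -/
theorem laplacian_transpose (h : IsWeightBalanced a) : laplacian aᵀ = (laplacian a)ᵀ := by
  unfold laplacian
  rw [Matrix.transpose_sub, Matrix.diagonal_transpose]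
  congr 2
  funext i
  exact (h i).symm

theorem symLaplacian_transpose (h : IsWeightBalanced a) : symLaplacian aᵀ = symLaplacian a := by
  unfold symLaplacian
  rw [laplacian_transpose h, Matrix.transpose_transpose, add_comm]

theorem symLaplacian_quadForm (a : Matrix (Fin N) (Fin N) ℝ) (x : Fin N → ℝ) :
    x ⬝ᵥ symLaplacian a *ᵥ x = x ⬝ᵥ laplacian a *ᵥ x := by
  unfold symLaplacian
  rw [Matrix.smul_mulVec, Matrix.add_mulVec, dotProduct_smul, dotProduct_add,
    Matrix.mulVec_transpose, dotProduct_comm x (x ᵥ* _), ← Matrix.dotProduct_mulVec, smul_eq_mul]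
  ring

/-- Since `2 xᵢ (xᵢ - xⱼ) = (xᵢ - xⱼ)² + (xᵢ² - xⱼ²)`, it suffices that the weighted sum of `xᵢ² -
xⱼ²` vanishes, which is weight balance. -/
theorem two_mul_laplacian_quadForm (h : IsWeightBalanced a) (x : Fin N → ℝ) :
    2 * (x ⬝ᵥ laplacian a *ᵥ x) = ∑ i, ∑ j, a i j * (x i - x j) ^ 2 := by
  have h1 : ∑ i, ∑ j, a i j * (x i ^ 2 - x j ^ 2) = 0 := by
    simp only [mul_sub, Finset.sum_sub_distrib]
    rw [sub_eq_zero]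
    conv_rhs => rw [Finset.sum_comm]
    refine Finset.sum_congr rfl fun i _ => ?_
    rw [← Finset.sum_mul, ← Finset.sum_mul, h i]
  rw [← sub_eq_zero, ← h1]
  simp only [dotProduct, laplacian_mulVec, Finset.mul_sum, ← Finset.sum_sub_distrib]
  refine Finset.sum_congr rfl fun i _ => Finset.sum_congr rfl fun j _ => ?_
  ring

theorem laplacian_quadForm_nonneg (ha : ∀ i j, 0 ≤ a i j) (h : IsWeightBalanced a)
    (x : Fin N → ℝ) : 0 ≤ x ⬝ᵥ laplacian a *ᵥ x := by
  have := two_mul_laplacian_quadForm h x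
  have h2 : 0 ≤ ∑ i, ∑ j, a i j * (x i - x j) ^ 2 :=
    Finset.sum_nonneg fun i _ => Finset.sum_nonneg fun j _ => mul_nonneg (ha i j) (sq_nonneg _)
  linarith

theorem sum_laplacian_mulVec (h : IsWeightBalanced a) (x : Fin N → ℝ) :
    ∑ i, (laplacian a *ᵥ x) i = 0 := by
  simp only [laplacian_mulVec, mul_sub, Finset.sum_sub_distrib]
  rw [sub_eq_zero]
  conv_rhs => rw [Finset.sum_comm]
  refine Finset.sum_congr rfl fun i _ => ?_
  rw [← Finset.sum_mul, ← Finset.sum_mul, h i]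

/-- The norm of the Laplacian is controlled by its quadratic form and its diagonal. -/
theorem laplacian_mulVec_dotProduct_self_le (ha : ∀ i j, 0 ≤ a i j) (h : IsWeightBalanced a)
    {r : ℝ} (hr : ∀ i, laplacian a i i ≤ r) (x : Fin N → ℝ) :
    (laplacian a *ᵥ x) ⬝ᵥ (laplacian a *ᵥ x) ≤ 2 * r * (x ⬝ᵥ laplacian a *ᵥ x) := by
  have key : ∀ i, (laplacian a *ᵥ x) i ^ 2 ≤ r * ∑ j, a i j * (x i - x j) ^ 2 := by
    intro i
    -- Self-loops contribute nothing to `L x`; without them the weights of row `i` sum to `L i i`,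
    -- and weighted Cauchy–Schwarz gives the factor `r`.
    rw [laplacian_mulVec, ← Finset.sum_erase Finset.univ (f := fun j => a i j * (x i - x j)) (a := i) (by simp),
      ← Finset.sum_erase Finset.univ (f := fun j => a i j * (x i - x j) ^ 2) (a := i)
        (by simp)]
    have hd : ∑ j ∈ Finset.univ.erase i, a i j ≤ r := by
      refine le_trans (le_of_eq ?_) (hr i)
      have := Finset.add_sum_erase Finset.univ (fun j => a i j) (Finset.mem_univ i)
      simp only [laplacian, Matrix.sub_apply, Matrix.diagonal_apply_eq]
      linarith
    refine (Finset.sum_sq_le_sum_mul_sum_of_sq_le_mul _ (f := fun j => a i j)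
      (g := fun j => a i j * (x i - x j) ^ 2) (fun j _ => ha i j)
      (fun j _ => mul_nonneg (ha i j) (sq_nonneg _)) (fun j _ => le_of_eq (by ring))).trans ?_
    exact mul_le_mul_of_nonneg_right hd
      (Finset.sum_nonneg fun j _ => mul_nonneg (ha i j) (sq_nonneg _))
  have h2 := two_mul_laplacian_quadForm h x
  calc (laplacian a *ᵥ x) ⬝ᵥ (laplacian a *ᵥ x) = ∑ i, (laplacian a *ᵥ x) i ^ 2 := by
        simp [dotProduct, sq]
    _ ≤ ∑ i, r * ∑ j, a i j * (x i - x j) ^ 2 := Finset.sum_le_sum fun i _ => key i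
    _ = 2 * r * (x ⬝ᵥ laplacian a *ᵥ x) := by rw [← Finset.mul_sum, ← h2]; ring

/-- A vanishing sum of squares forces equality across every edge, and directed paths propagate it.
-/
theorem eq_of_laplacian_quadForm_eq_zero (ha : ∀ i j, 0 ≤ a i j) (h : IsWeightBalanced a)
    (hc : IsStronglyConnected a) {x : Fin N → ℝ} (hx : x ⬝ᵥ laplacian a *ᵥ x = 0) (p q : Fin N) :
    x p = x q := by
  have h2 := two_mul_laplacian_quadForm h x
  rw [hx, mul_zero, eq_comm, Finset.sum_eq_zero_iff_of_nonneg
    (fun i _ => Finset.sum_nonneg fun j _ => mul_nonneg (ha i j) (sq_nonneg _))] at h2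
  have h3 : ∀ i j, 0 < a i j → x j = x i := by
    intro i j hij
    have := h2 i (Finset.mem_univ i)
    rw [Finset.sum_eq_zero_iff_of_nonneg (fun j _ => mul_nonneg (ha i j) (sq_nonneg _))] at this
    have := this j (Finset.mem_univ j)
    rcases mul_eq_zero.1 this with h | h
    · exact absurd h hij.ne'
    · have := pow_eq_zero_iff (two_ne_zero) |>.1 h
      linarith
  have h4 := hc p q
  induction h4 with
  | refl => rfl
  | tail _ hab ih => exact ih.trans (h3 _ _ hab)

/-! ### The eigenvalues `λ₂` and `λ_N` -/

theorem eigenvalues_le_lambdaMax (hN : 2 ≤ N) (k : Fin N) :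
    (symLaplacian_isHermitian a).eigenvalues k ≤ lambdaMax hN a := by
  unfold lambdaMax symLaplacianEigenvalue Matrix.IsHermitian.eigenvalues
  apply (symLaplacian_isHermitian a).eigenvalues₀_antitone
  rw [Fin.le_def]
  simp [Fin.val_rev]
  omega

/-- A diagonal entry is the Rayleigh quotient of a standard basis vector. -/
theorem laplacian_diag_le_lambdaMax (hN : 2 ≤ N) (i : Fin N) :
    laplacian a i i ≤ lambdaMax hN a := by
  have := quadForm_le (symLaplacian_isHermitian a) (eigenvalues_le_lambdaMax hN) (Pi.single i 1)
  rw [symLaplacian_quadForm] at this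
  simpa using this

theorem lambdaTwo_le_lambdaMax (hN : 2 ≤ N) : lambdaTwo hN a ≤ lambdaMax hN a := by
  unfold lambdaTwo lambdaMax symLaplacianEigenvalue
  apply (symLaplacian_isHermitian a).eigenvalues₀_antitone
  rw [Fin.le_def]
  simp [Fin.val_rev]
  omega

/-- Exactly one eigenvalue vanishes, and its eigenvector is constant. -/
theorem exists_eigenvalue_zero (hN : 2 ≤ N) (ha : ∀ i j, 0 ≤ a i j) (h : IsWeightBalanced a)
    (hc : IsStronglyConnected a) :
    ∃ k₀, (symLaplacian_isHermitian a).eigenvalues k₀ = 0 ∧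
      (∀ k, k ≠ k₀ → 0 < (symLaplacian_isHermitian a).eigenvalues k) ∧
      ∀ p q, (symLaplacian_isHermitian a).eigenvectorBasis k₀ p =
        (symLaplacian_isHermitian a).eigenvectorBasis k₀ q := by
  set hS := symLaplacian_isHermitian a
  have hnn : ∀ k, 0 ≤ hS.eigenvalues k := fun k => by
    rw [eigenvalue_eq_quadForm, symLaplacian_quadForm]
    exact laplacian_quadForm_nonneg ha h _
  have hconst : ∀ k, hS.eigenvalues k = 0 → ∀ p q,
      hS.eigenvectorBasis k p = hS.eigenvectorBasis k q := fun k hk => by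
    rw [eigenvalue_eq_quadForm, symLaplacian_quadForm] at hk
    exact eq_of_laplacian_quadForm_eq_zero ha h hc hk
  -- The all-ones vector has zero quadratic form; were all eigenvalues positive, its
  -- eigencoordinates would all vanish.
  have hex : ∃ k, hS.eigenvalues k = 0 := by
    by_contra! hne
    have hone : (fun _ : Fin N => (1 : ℝ)) ⬝ᵥ laplacian a *ᵥ (fun _ => 1) = 0 := by
      simp [dotProduct, laplacian_mulVec]
    rw [← symLaplacian_quadForm, quadForm_eq_sum hS,
      Finset.sum_eq_zero_iff_of_nonneg (fun k _ => mul_nonneg (hnn k) (sq_nonneg _))] at hone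
    have hz : (fun _ : Fin N => (1 : ℝ)) ⬝ᵥ (fun _ => 1) = 0 := by
      rw [dotProduct_self_eq_sum hS]
      refine Finset.sum_eq_zero fun k hk => ?_
      rcases mul_eq_zero.1 (hone k hk) with h | h
      · exact absurd h (hne k)
      · exact h
    simp [dotProduct] at hz
    omega
  obtain ⟨k₀, hk₀⟩ := hex
  refine ⟨k₀, hk₀, fun k hk => lt_of_le_of_ne (hnn k) fun h0 => ?_, hconst k₀ hk₀⟩
  have h1 := eigenvectorBasis_dotProduct_ne hS hk
  have h2 := eigenvectorBasis_dotProduct_self hS k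
  have h3 := eigenvectorBasis_dotProduct_self hS k₀
  -- A second zero eigenvalue would give two orthonormal constant vectors, which is impossible.
  have i0 : Fin N := ⟨0, by omega⟩
  have e1 : (⇑(hS.eigenvectorBasis k) : Fin N → ℝ) = fun _ => hS.eigenvectorBasis k i0 :=
    funext fun p => hconst k h0.symm p i0
  have e2 : (⇑(hS.eigenvectorBasis k₀) : Fin N → ℝ) = fun _ => hS.eigenvectorBasis k₀ i0 :=
    funext fun p => hconst k₀ hk₀ p i0
  rw [e1] at h1 h2
  rw [e2] at h1 h3
  simp only [dotProduct, Finset.sum_const, Finset.card_univ, Fintype.card_fin, nsmul_eq_mul,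
    mul_eq_zero, Nat.cast_eq_zero] at h1 h2 h3
  rcases h1 with h | h | h 
  · omega
  · simp [h] at h2
  · simp [h] at h3

theorem lambdaTwo_pos (hN : 2 ≤ N) (ha : ∀ i j, 0 ≤ a i j) (h : IsWeightBalanced a)
    (hc : IsStronglyConnected a) : 0 < lambdaTwo hN a := by
  obtain ⟨k₀, hk₀, hpos, -⟩ := exists_eigenvalue_zero hN ha h hc
  set e := (Fintype.equivOfCardEq (Fintype.card_fin (Fintype.card (Fin N)))).symm with he
  set l : Fin (Fintype.card (Fin N)) :=
    Fin.cast (Fintype.card_fin N).symm (Fin.rev ⟨1, by omega⟩) with hl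
  set l' : Fin (Fintype.card (Fin N)) :=
    Fin.cast (Fintype.card_fin N).symm (Fin.rev ⟨0, by omega⟩) with hl'
  have hll : l ≠ l' := by
    simp [hl, hl', Fin.ext_iff, Fin.val_rev]; omega
  have hle : (symLaplacian_isHermitian a).eigenvalues₀ l' ≤
      (symLaplacian_isHermitian a).eigenvalues₀ l := by
    apply (symLaplacian_isHermitian a).eigenvalues₀_antitone
    rw [Fin.le_def]
    simp [hl, hl', Fin.val_rev]
    omega
  have hev : ∀ j, (symLaplacian_isHermitian a).eigenvalues (e.symm j) =
      (symLaplacian_isHermitian a).eigenvalues₀ j := fun j => by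
    simp [Matrix.IsHermitian.eigenvalues, he]
  show 0 < (symLaplacian_isHermitian a).eigenvalues₀ l
  -- `l` and `l'` are the positions of the second smallest and the smallest eigenvalue. At most one
  -- of them carries the zero eigenvalue; if `l` did, the value at `l'` would be positive, and it is
  -- at most the value at `l`.
  by_cases hk : e.symm l = k₀
  · have : e.symm l' ≠ k₀ := fun h => hll (e.symm.injective (hk.trans h.symm))
    have := hpos _ this
    rw [hev] at this
    exact this.trans_le hle
  · rw [← hev]; exact hpos _ hk

/-- A zero-sum vector is orthogonal to the constant eigenvector, and every other eigenvalue is at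
least `λ₂`. -/
theorem lambdaTwo_mul_le (hN : 2 ≤ N) (ha : ∀ i j, 0 ≤ a i j) (h : IsWeightBalanced a)
    (hc : IsStronglyConnected a) {x : Fin N → ℝ} (hx : ∑ i, x i = 0) :
    lambdaTwo hN a * (x ⬝ᵥ x) ≤ x ⬝ᵥ laplacian a *ᵥ x := by
  obtain ⟨k₀, hk₀, hpos, hconst⟩ := exists_eigenvalue_zero hN ha h hc
  rw [← symLaplacian_quadForm]
  refine le_quadForm (symLaplacian_isHermitian a) x fun k => ?_
  by_cases hk : k = k₀
  · right
    have i0 : Fin N := ⟨0, by omega⟩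
    subst hk
    simp only [eigenCoord, dotProduct]
    rw [Finset.sum_congr rfl fun p _ => by rw [hconst p i0], ← Finset.mul_sum, hx, mul_zero]
  · left
    have hkpos := hpos k hk
    by_contra! hlt
    -- otherwise both `k` and `k₀` come after the second smallest index
    unfold lambdaTwo symLaplacianEigenvalue Matrix.IsHermitian.eigenvalues at hlt
    have hl2 : (symLaplacian_isHermitian a).eigenvalues k₀ < lambdaTwo hN a := by
      rw [hk₀]; exact lambdaTwo_pos hN ha h hc
    unfold lambdaTwo symLaplacianEigenvalue Matrix.IsHermitian.eigenvalues at hl2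
    have g1 := (symLaplacian_isHermitian a).eigenvalues₀_antitone.reflect_lt hlt
    have g2 := (symLaplacian_isHermitian a).eigenvalues₀_antitone.reflect_lt hl2
    have hne : (Fintype.equivOfCardEq (Fintype.card_fin (Fintype.card (Fin N)))).symm k ≠
        (Fintype.equivOfCardEq (Fintype.card_fin (Fintype.card (Fin N)))).symm k₀ :=
      fun h => hk (Equiv.injective _ h)
    rw [Fin.lt_def] at g1 g2
    rw [Ne, Fin.ext_iff] at hne
    have b1 := Fin.isLt ((Fintype.equivOfCardEq (Fintype.card_fin (Fintype.card (Fin N)))).symm k)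
    have b2 := Fin.isLt ((Fintype.equivOfCardEq (Fintype.card_fin (Fintype.card (Fin N)))).symm k₀)
    have := Fintype.card_fin N
    simp only [Fin.val_cast, Fin.val_rev] at g1 g2
    omega

end Laplacian

/-! ### The distributed optimizer -/

/-- The dissipation inequality of the distributed optimizer, in terms of scalar products. -/
theorem optimizer_dissipation {α β η hl hb l₂ l₃ Y Q A B w s₁ s₂ s₃ : ℝ}
    (hα : 1 ≤ α) (hl_pos : 0 < hl) (hl₂ : 0 < l₂) (hl₃ : l₂ ≤ l₃) (hη₁ : 2 * η ≤ α * hl)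
    (hη₂ : 2 * η ≤ α * l₂) (hαh : 6 * hb ^ 2 ≤ α * (hl * l₂))
    (hβ : 7 * α ^ 2 * l₃ ^ 2 ≤ β * l₂ ^ 2) (hY : 0 ≤ Y) (hQ : 0 ≤ Q) (hA : 0 ≤ A)
    (hB : l₂ * Q ≤ B) (hw : hl * Y ≤ w) (hs₁ : s₁ ^ 2 ≤ Q * (2 * l₃ * A))
    (hs₂ : s₂ ^ 2 ≤ Q * (2 * l₃ * A)) (hs₃ : s₃ ^ 2 ≤ Q * (hb ^ 2 * Y)) :
    -α * w - (β - α) * A - s₁ + 1 / α ^ 3 * (-α * B + α ^ 2 * s₂ - α ^ 2 * s₃)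
      ≤ -η * (Y + 1 / α ^ 3 * Q) := by
  have hα0 : 0 < α := by linarith
  have hl₃0 : 0 < l₃ := by linarith
  -- Of the 7 in the condition on `β`, one unit pays for the loss of `α` in `β - α`; six remain.
  have hβα : 6 * α ^ 2 * l₃ ≤ (β - α) * l₂ := by
    have e1 : α * l₂ ^ 2 ≤ α ^ 2 * l₃ ^ 2 := by
      have : α ≤ α ^ 2 := by nlinarith
      exact mul_le_mul this (by gcongr) (by positivity) (by positivity)
    have e2 : 6 * α ^ 2 * l₃ * l₂ ≤ 6 * α ^ 2 * l₃ * l₃ := by gcongr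
    have : 6 * α ^ 2 * l₃ * l₂ ≤ (β - α) * l₂ * l₂ := by nlinarith
    exact le_of_mul_le_mul_right this hl₂
  have hβα0 : 0 ≤ β - α := by
    by_contra! hneg
    have : (β - α) * l₂ < 0 := mul_neg_of_neg_of_pos hneg hl₂
    have : 0 < 6 * α ^ 2 * l₃ := by positivity
    linarith
  have hbound : Q * (2 * l₃ * A) ≤ 4 * ((β - α) / 2 * A * (l₂ * Q / (6 * α ^ 2))) := by
    have : 4 * ((β - α) / 2 * A * (l₂ * Q / (6 * α ^ 2)))
        = Q * ((β - α) * l₂ / (3 * α ^ 2) * A) := by field_simp; ring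
    rw [this]
    gcongr
    rw [le_div_iff₀ (by positivity)]
    linarith
  -- Budget: `s₁` and `s₂ / α` each take half of `(β - α) A` and one sixth of `l₂ Q / α²`; `s₃ / α`
  -- takes half of `α hl Y` and one twelfth of `l₂ Q / α²`. Half of `α hl Y` and 7/12 of `l₂ Q / α²`
  -- are left, enough for the decay `η`.
  have b₁ := abs_le_add_of_sq_le (s := s₁) (by positivity) (by positivity) (hs₁.trans hbound)
  have b₂ := abs_le_add_of_sq_le (s := s₂) (by positivity) (by positivity) (hs₂.trans hbound)
  have b₃ := abs_le_add_of_sq_le (s := s₃) (u := α ^ 2 * hl / 2 * Y) (v := l₂ * Q / (12 * α))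
    (by positivity) (by positivity) (hs₃.trans (by
      have : 4 * (α ^ 2 * hl / 2 * Y * (l₂ * Q / (12 * α))) = Q * (α * (hl * l₂) / 6 * Y) := by
        field_simp; ring
      rw [this]
      gcongr
      linarith))
  have c₁ := (abs_le.1 b₁).1
  have c₂ : s₂ / α ≤ (β - α) / 2 * A + l₂ * Q / (6 * α ^ 2) :=
    (div_le_self (abs_nonneg s₂) hα |>.trans' (by gcongr; exact le_abs_self _)).trans b₂
  have c₃ : -s₃ / α ≤ α * hl / 2 * Y + l₂ * Q / (12 * α ^ 2) := by
    rw [div_le_iff₀ hα0]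
    have : (α * hl / 2 * Y + l₂ * Q / (12 * α ^ 2)) * α
        = α ^ 2 * hl / 2 * Y + l₂ * Q / (12 * α) := by field_simp
    rw [this]
    linarith [neg_abs_le s₃]
  have c₄ : l₂ * Q / α ^ 2 ≤ B / α ^ 2 := by gcongr
  have c₅ : α * (hl * Y) ≤ α * w := by gcongr
  have c₆ : η * Y ≤ α * hl / 2 * Y := by gcongr; linarith
  have c₇ : η * (1 / α ^ 3 * Q) ≤ l₂ * Q / α ^ 2 / 2 := by
    have : l₂ * Q / α ^ 2 / 2 = α * l₂ / 2 * (1 / α ^ 3 * Q) := by field_simp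
    rw [this]
    gcongr
    linarith
  have c₈ : 0 ≤ l₂ * Q / α ^ 2 := by positivity
  have e₁ : 1 / α ^ 3 * (-α * B + α ^ 2 * s₂ - α ^ 2 * s₃) = -(B / α ^ 2) + s₂ / α + -s₃ / α := by
    field_simp
    ring
  have e₂ : l₂ * Q / (6 * α ^ 2) = l₂ * Q / α ^ 2 / 6 := by field_simp
  have e₃ : l₂ * Q / (12 * α ^ 2) = l₂ * Q / α ^ 2 / 12 := by field_simp
  rw [e₁]
  rw [e₂] at c₁ c₂
  rw [e₃] at c₃
  linarith

/-- The right-hand side of the equation for `z` of the distributed optimizer. -/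
noncomputable def optimizerRate {N : ℕ} (a : Matrix (Fin N) (Fin N) ℝ) (φ : Fin N → ℝ → ℝ)
    (α β : ℝ) (z v : Fin N → ℝ → ℝ) (i : Fin N) (s : ℝ) : ℝ :=
  -α * φ i (z i s) - β * ∑ j, a i j * (z i s - z j s) - ∑ j, a i j * (v i s - v j s)

section Optimizer

variable {N : ℕ} {a : Matrix (Fin N) (Fin N) ℝ}

/-- `L + J`, with `J` the all-ones matrix, is invertible: summing the entries of `(L + J) x`
isolates the sum of `x`, and on zero-sum vectors `L` is injective by `λ₂ > 0`. The solution for a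
zero-sum `w` has zero sum itself, so `J` drops out. -/
theorem exists_laplacian_mulVec_eq (hN : 2 ≤ N) (ha : ∀ i j, 0 ≤ a i j) (h : IsWeightBalanced a)
    (hc : IsStronglyConnected a) {w : Fin N → ℝ} (hw : ∑ i, w i = 0) :
    ∃ x, laplacian a *ᵥ x = w := by
  let J : Matrix (Fin N) (Fin N) ℝ := Matrix.of fun _ _ => 1
  have hJ : ∀ x i, (J *ᵥ x) i = ∑ j, x j := fun x i => by simp [J, Matrix.mulVec, dotProduct]
  have hsum : ∀ x, ∑ i, ((laplacian a + J) *ᵥ x) i = N * ∑ j, x j := fun x => by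
    simp only [Matrix.add_mulVec, Pi.add_apply, Finset.sum_add_distrib,
      sum_laplacian_mulVec h, hJ]
    simp
  have hN0 : (N : ℝ) ≠ 0 := by
    have : N ≠ 0 := by omega
    exact_mod_cast this
  have hinj : Function.Injective (laplacian a + J).mulVecLin := by
    rw [← LinearMap.ker_eq_bot, LinearMap.ker_eq_bot']
    intro x hx
    rw [Matrix.mulVecLin_apply] at hx
    have h0 : ∑ j, x j = 0 := by
      have := hsum x
      rw [hx] at this
      simpa [hN0] using this
    have hL : laplacian a *ᵥ x = 0 := by
      rw [Matrix.add_mulVec] at hx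
      have : J *ᵥ x = 0 := funext fun i => by rw [hJ, h0]; rfl
      rwa [this, add_zero] at hx
    have := lambdaTwo_mul_le hN ha h hc h0
    rw [hL, dotProduct_zero] at this
    have hxx : x ⬝ᵥ x = 0 :=
      le_antisymm (nonpos_of_mul_nonpos_right this (lambdaTwo_pos hN ha h hc))
        (dotProduct_self_nonneg' x)
    exact dotProduct_self_eq_zero.1 hxx
  obtain ⟨x, hx⟩ := LinearMap.injective_iff_surjective.1 hinj w
  rw [Matrix.mulVecLin_apply] at hx
  have h0 : ∑ j, x j = 0 := by
    have := hsum x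
    rw [hx, hw] at this
    simpa [hN0] using this.symm
  refine ⟨x, ?_⟩
  rw [Matrix.add_mulVec] at hx
  have : J *ᵥ x = 0 := funext fun i => by rw [hJ, h0]; rfl
  rwa [this, add_zero] at hx

theorem laplacian_mulVec_const_shift (x : Fin N → ℝ) (r : ℝ) :
    laplacian a *ᵥ (fun i => x i - r) = laplacian a *ᵥ x := by
  funext i
  simp [laplacian_mulVec]

/-- The optimizer converges to the minimizer, and its velocity to zero, at the rate `η`. -/
theorem optimizer_convergence (hN : 2 ≤ N) (ha : ∀ i j, 0 ≤ a i j) (hbal : IsWeightBalanced a)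
    (hconn : IsStronglyConnected a) {φ : Fin N → ℝ → ℝ} {ystar hl hb α β η : ℝ}
    (hφ_lo : ∀ i s, hl * (s - ystar) ^ 2 ≤ (s - ystar) * (φ i s - φ i ystar))
    (hφ_hi : ∀ i s, (φ i s - φ i ystar) ^ 2 ≤ hb ^ 2 * (s - ystar) ^ 2)
    (hφ : ∑ i, φ i ystar = 0)
    (hα : 1 ≤ α) (hl_pos : 0 < hl) (hη₁ : 2 * η ≤ α * hl) (hη₂ : 2 * η ≤ α * lambdaTwo hN a)
    (hαh : 6 * hb ^ 2 ≤ α * (hl * lambdaTwo hN a))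
    (hβ : 7 * α ^ 2 * lambdaMax hN a ^ 2 ≤ β * lambdaTwo hN a ^ 2)
    {z v : Fin N → ℝ → ℝ}
    (hz : ∀ i, ∀ s : ℝ, 0 ≤ s →
      HasDerivWithinAt (z i) (optimizerRate a φ α β z v i s) (Ici 0) s)
    (hv : ∀ i, ∀ s : ℝ, 0 ≤ s → HasDerivWithinAt (v i)
      (α * β * ∑ j, a i j * (z i s - z j s)) (Ici 0) s) :
    ∃ M : ℝ, 0 ≤ M ∧ ∀ i, ∀ s : ℝ, 0 ≤ s → |z i s - ystar| ≤ M * Real.exp (-η * s) ∧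
      |optimizerRate a φ α β z v i s| ≤ M * Real.exp (-η * s) := by
  have hα0 : 0 < α := by linarith
  have hN0 : (N : ℝ) ≠ 0 := by
    have : N ≠ 0 := by omega
    exact_mod_cast this
  have hl₂ := lambdaTwo_pos hN ha hbal hconn
  have hl₃ := lambdaTwo_le_lambdaMax (a := a) hN
  -- The equilibrium condition for `z = y*`; it is solvable because the gradients sum to zero at the
  -- minimizer.
  obtain ⟨vs, hvs⟩ := exists_laplacian_mulVec_eq hN ha hbal hconn
    (w := fun i => -α * φ i ystar) (by rw [← Finset.mul_sum, hφ, mul_zero])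
  set L := laplacian a with hLdef
  -- error coordinates
  let y : ℝ → Fin N → ℝ := fun s i => z i s - ystar
  let g : ℝ → Fin N → ℝ := fun s i => φ i (z i s) - φ i ystar
  let p : ℝ → Fin N → ℝ := fun s i => v i s - vs i + α * y s i
  -- Removing the mean does not affect `L p`, and it makes the `λ₂` bound applicable.
  let q : ℝ → Fin N → ℝ := fun s i => p s i - (∑ j, p s j) / N
  let y' : ℝ → Fin N → ℝ := fun s => -α • g s - (β - α) • (L *ᵥ y s) - L *ᵥ q s
  let p' : ℝ → Fin N → ℝ := fun s => -α • (L *ᵥ q s) + α ^ 2 • (L *ᵥ y s) - α ^ 2 • g s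
  let q' : ℝ → Fin N → ℝ := fun s i => p' s i - (∑ j, p' s j) / N
  have hLz : ∀ s, L *ᵥ y s = L *ᵥ (fun i => z i s) := fun s =>
    laplacian_mulVec_const_shift (fun i => z i s) ystar
  have hLq : ∀ s, L *ᵥ q s = L *ᵥ (fun i => v i s) - L *ᵥ vs + α • (L *ᵥ y s) := fun s => by
    rw [show L *ᵥ q s = L *ᵥ p s from laplacian_mulVec_const_shift (p s) _,
      ← Matrix.mulVec_smul, ← Matrix.mulVec_sub, ← Matrix.mulVec_add]
    rfl
  have hrate : ∀ i s, optimizerRate a φ α β z v i s = y' s i := fun i s => by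
    have e1 := congrFun (hLz s) i
    have e2 := congrFun (hLq s) i
    have e3 := congrFun hvs i
    have e4 := laplacian_mulVec a (fun i => z i s) i
    have e5 := laplacian_mulVec a (fun i => v i s) i
    simp only [← hLdef, Pi.add_apply, Pi.sub_apply, Pi.smul_apply, smul_eq_mul] at e1 e2 e3 e4 e5
    simp only [optimizerRate, y', g, Pi.sub_apply, Pi.smul_apply, smul_eq_mul]
    rw [← e4, ← e5, e2, e1, e3]
    ring
  have hy_d : ∀ i, ∀ s : ℝ, 0 ≤ s → HasDerivWithinAt (fun s => y s i) (y' s i) (Ici 0) s :=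
    fun i s hs => by rw [← hrate]; exact (hz i s hs).sub_const _
  have hp_d : ∀ i, ∀ s : ℝ, 0 ≤ s → HasDerivWithinAt (fun s => p s i) (p' s i) (Ici 0) s :=
    fun i s hs => by
      refine (((hv i s hs).sub_const (vs i)).add ((hy_d i s hs).const_mul α)).congr_deriv ?_
      have e1 := congrFun (hLz s) i
      have e4 := laplacian_mulVec a (fun i => z i s) i
      simp only [p', y', Pi.add_apply, Pi.sub_apply, Pi.smul_apply, smul_eq_mul]
      rw [← e4, ← hLdef, ← e1]
      ring
  have hq_d : ∀ i, ∀ s : ℝ, 0 ≤ s → HasDerivWithinAt (fun s => q s i) (q' s i) (Ici 0) s :=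
    fun i s hs => (hp_d i s hs).sub
      ((HasDerivWithinAt.fun_sum fun j _ => hp_d j s hs).div_const _)
  have hq_sum : ∀ s, ∑ i, q s i = 0 := fun s => by
    simp only [q, Finset.sum_sub_distrib, Finset.sum_const, Finset.card_univ, Fintype.card_fin,
      nsmul_eq_mul]
    field_simp
    ring
  -- the Lyapunov function
  let V : ℝ → ℝ := fun s => y s ⬝ᵥ y s + 1 / α ^ 3 * (q s ⬝ᵥ q s)
  have hV_d : ∀ s : ℝ, 0 ≤ s → HasDerivWithinAt V
      (2 * (y s ⬝ᵥ y' s + 1 / α ^ 3 * (q s ⬝ᵥ p' s))) (Ici 0) s := fun s hs => by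
    have e : q s ⬝ᵥ q' s = q s ⬝ᵥ p' s := by
      simp only [q', dotProduct, mul_sub, Finset.sum_sub_distrib]
      rw [← Finset.sum_mul, hq_sum]
      ring
    have d1 : HasDerivWithinAt (fun s => y s ⬝ᵥ y s) _ (Ici 0) s :=
      HasDerivWithinAt.fun_sum fun i _ => (hy_d i s hs).mul (hy_d i s hs)
    have d2 : HasDerivWithinAt (fun s => q s ⬝ᵥ q s) _ (Ici 0) s :=
      HasDerivWithinAt.fun_sum fun i _ => (hq_d i s hs).mul (hq_d i s hs)
    refine (d1.add (d2.const_mul (1 / α ^ 3))).congr_deriv ?_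
    rw [← e, Finset.sum_add_distrib, Finset.sum_add_distrib]
    simp only [dotProduct]
    simp only [mul_comm (y' s _), mul_comm (q' s _)]
    ring
  have hdiss : ∀ s, 2 * (y s ⬝ᵥ y' s + 1 / α ^ 3 * (q s ⬝ᵥ p' s)) ≤ -(2 * η) * V s := fun s => by
    have hLT : ∀ x w : Fin N → ℝ, (x ⬝ᵥ L *ᵥ w) ^ 2 ≤
        (x ⬝ᵥ x) * (2 * lambdaMax hN a * (w ⬝ᵥ L *ᵥ w)) := fun x w =>
      (dotProduct_sq_le _ _).trans (mul_le_mul_of_nonneg_left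
        (laplacian_mulVec_dotProduct_self_le ha hbal (laplacian_diag_le_lambdaMax hN) w)
        (dotProduct_self_nonneg' x))
    have key := optimizer_dissipation (α := α) (β := β) (η := η) (hl := hl) (hb := hb)
      (l₂ := lambdaTwo hN a) (l₃ := lambdaMax hN a)
      (Y := y s ⬝ᵥ y s) (Q := q s ⬝ᵥ q s) (A := y s ⬝ᵥ L *ᵥ y s) (B := q s ⬝ᵥ L *ᵥ q s)
      (w := y s ⬝ᵥ g s) (s₁ := y s ⬝ᵥ L *ᵥ q s) (s₂ := q s ⬝ᵥ L *ᵥ y s) (s₃ := q s ⬝ᵥ g s)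
      hα hl_pos hl₂ hl₃ hη₁ hη₂ hαh hβ (dotProduct_self_nonneg' _) (dotProduct_self_nonneg' _)
      (laplacian_quadForm_nonneg ha hbal _) (lambdaTwo_mul_le hN ha hbal hconn (hq_sum s))
      (by
        simp only [dotProduct, Finset.mul_sum]
        refine Finset.sum_le_sum fun i _ => ?_
        have := hφ_lo i (z i s)
        simp only [y, g]
        nlinarith)
      (by
        -- The factor `L` must fall on `y`, so that `(β - α) yᵀ L y` can absorb this term. This
        -- produces `Lᵀ`, the Laplacian of the reversed graph, which has the same quadratic form.
        have e : y s ⬝ᵥ L *ᵥ q s = q s ⬝ᵥ laplacian aᵀ *ᵥ y s := by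
          rw [laplacian_transpose hbal, Matrix.mulVec_transpose, Matrix.dotProduct_mulVec,
            dotProduct_comm]
        have e' : y s ⬝ᵥ L *ᵥ y s = y s ⬝ᵥ laplacian aᵀ *ᵥ y s := by
          rw [← symLaplacian_quadForm, ← symLaplacian_quadForm, symLaplacian_transpose hbal]
        rw [e, e']
        refine (dotProduct_sq_le _ _).trans (mul_le_mul_of_nonneg_left
          (laplacian_mulVec_dotProduct_self_le (a := aᵀ) (fun i j => ha j i) hbal.transpose ?_ _)
          (dotProduct_self_nonneg' _))
        intro i
        rw [laplacian_transpose hbal]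
        exact laplacian_diag_le_lambdaMax hN i)
      (hLT _ _)
      ((dotProduct_sq_le _ _).trans (mul_le_mul_of_nonneg_left (by
        simp only [dotProduct, Finset.mul_sum]
        refine Finset.sum_le_sum fun i _ => ?_
        have := hφ_hi i (z i s)
        simp only [y, g]
        nlinarith) (dotProduct_self_nonneg' _)))
    simp only [y', p', V, dotProduct_add, dotProduct_sub, dotProduct_smul, smul_eq_mul] at key ⊢
    linarith
  have hVexp : ∀ s : ℝ, 0 ≤ s → V s ≤ V 0 * Real.exp (-η * s) ^ 2 := fun s hs => by
    have := le_add_exp_of_deriv_right_le (V := V) (b := s) (δ := 2 * η) (ρ := 2 * η) (D := 0)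
      (E := V 0) (V' := fun s => 2 * (y s ⬝ᵥ y' s + 1 / α ^ 3 * (q s ⬝ᵥ p' s)))
      (fun u hu => (hV_d u hu.1).continuousWithinAt.mono (fun w hw => hw.1))
      (fun u hu => (hV_d u hu.1).mono (Ici_subset_Ici.2 hu.1))
      (fun u _ => by simpa using hdiss u) (by simp) s ⟨hs, le_rfl⟩
    rw [← Real.exp_nat_mul]
    refine this.trans (le_of_eq ?_)
    rw [zero_add]
    congr 2
    push_cast
    ring
  have hV0 : 0 ≤ V 0 := by
    have := dotProduct_self_nonneg' (y 0)
    have := dotProduct_self_nonneg' (q 0)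
    positivity
  set R := Real.sqrt (V 0) with hR
  have hyb : ∀ i, ∀ s : ℝ, 0 ≤ s → |y s i| ≤ R * Real.exp (-η * s) := fun i s hs => by
    refine abs_le_of_sq_le_sq ?_ (by positivity)
    rw [mul_pow, hR, Real.sq_sqrt hV0]
    refine le_trans ?_ (hVexp s hs)
    have h1 : y s i * y s i ≤ y s ⬝ᵥ y s :=
      Finset.single_le_sum (f := fun i => y s i * y s i) (fun i _ => mul_self_nonneg _)
        (Finset.mem_univ i)
    have h2 : 0 ≤ 1 / α ^ 3 * (q s ⬝ᵥ q s) :=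
      mul_nonneg (by positivity) (dotProduct_self_nonneg' _)
    simp only [V]
    nlinarith
  have hqb : ∀ i, ∀ s : ℝ, 0 ≤ s → |q s i| ≤ α ^ 2 * R * Real.exp (-η * s) := fun i s hs => by
    refine abs_le_of_sq_le_sq ?_ (by positivity)
    rw [mul_pow, mul_pow, hR, Real.sq_sqrt hV0, mul_assoc]
    have h1 : q s i * q s i ≤ q s ⬝ᵥ q s :=
      Finset.single_le_sum (f := fun i => q s i * q s i) (fun i _ => mul_self_nonneg _)
        (Finset.mem_univ i)
    have h2 : q s ⬝ᵥ q s = α ^ 3 * (1 / α ^ 3 * (q s ⬝ᵥ q s)) := by field_simp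
    have h3 : 1 / α ^ 3 * (q s ⬝ᵥ q s) ≤ V s := by
      have := dotProduct_self_nonneg' (y s)
      simp only [V]; linarith
    have h4 := hVexp s hs
    -- The sharp constant `α^{3/2}` is relaxed to `α²` to avoid a root.
    have h5 : α ^ 3 ≤ (α ^ 2) ^ 2 := by
      rw [← pow_mul]; exact pow_le_pow_right₀ hα (by norm_num)
    calc q s i ^ 2 ≤ α ^ 3 * (1 / α ^ 3 * (q s ⬝ᵥ q s)) := by rw [← h2, sq]; exact h1
      _ ≤ α ^ 3 * (V 0 * Real.exp (-η * s) ^ 2) :=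
        mul_le_mul_of_nonneg_left (h3.trans h4) (by positivity)
      _ ≤ _ := by gcongr
  have hLb : ∀ (x : Fin N → ℝ) (r : ℝ), 0 ≤ r → (∀ i, |x i| ≤ r) → ∀ i,
      |(L *ᵥ x) i| ≤ (∑ i, ∑ j, |L i j|) * r := fun x r hr hx i => by
    change |∑ j, L i j * x j| ≤ _
    refine (Finset.abs_sum_le_sum_abs _ _).trans ?_
    have : ∑ j, |L i j| ≤ ∑ i, ∑ j, |L i j| :=
      Finset.single_le_sum (f := fun i => ∑ j, |L i j|)
        (fun i _ => Finset.sum_nonneg fun j _ => abs_nonneg _) (Finset.mem_univ i)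
    refine le_trans ?_ (mul_le_mul_of_nonneg_right this hr)
    rw [Finset.sum_mul]
    exact Finset.sum_le_sum fun j _ => by rw [abs_mul]; gcongr; exact hx j
  set Λ := ∑ i, ∑ j, |L i j|
  have hΛ : 0 ≤ Λ := Finset.sum_nonneg fun i _ => Finset.sum_nonneg fun j _ => abs_nonneg _
  have hR0 : 0 ≤ R := Real.sqrt_nonneg _
  refine ⟨R + (α * |hb| * R + |β - α| * (Λ * R) + Λ * (α ^ 2 * R)), by positivity,
    fun i s hs => ⟨?_, ?_⟩⟩
  · refine (hyb i s hs).trans ?_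
    gcongr
    have : 0 ≤ α * |hb| * R + |β - α| * (Λ * R) + Λ * (α ^ 2 * R) := by positivity
    linarith
  · rw [hrate]
    set E := Real.exp (-η * s) with hE
    have hE0 : 0 ≤ E := (Real.exp_pos _).le
    have k1 : |g s i| ≤ |hb| * (R * E) := by
      refine (abs_le_of_sq_le_sq (b := |hb| * |y s i|) ?_ (by positivity)).trans ?_
      · rw [mul_pow, sq_abs, sq_abs]; exact hφ_hi i (z i s)
      · gcongr; exact hyb i s hs
    have k2 := hLb (y s) (R * E) (by positivity) (fun i => hyb i s hs) i
    have k3 := hLb (q s) (α ^ 2 * R * E) (by positivity) (fun i => hqb i s hs) i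
    have k4 : |y' s i| ≤ α * |g s i| + |β - α| * |(L *ᵥ y s) i| + |(L *ᵥ q s) i| := by
      simp only [y', Pi.sub_apply, Pi.smul_apply, smul_eq_mul]
      refine (abs_sub _ _).trans (add_le_add_left ((abs_sub _ _).trans ?_) _)
      rw [abs_mul, abs_mul, abs_neg, abs_of_pos hα0]
    have k5 : α * |g s i| ≤ α * (|hb| * (R * E)) := by gcongr
    have k6 : |β - α| * |(L *ᵥ y s) i| ≤ |β - α| * (Λ * (R * E)) := by gcongr
    have k7 : 0 ≤ R * E := by positivity
    nlinarith

end Optimizer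

/-! ### Lyapunov estimates for the tracking error -/

theorem exists_pos_forall_le {ι : Type*} [Finite ι] {g : ι → ℝ} (hg : ∀ i, 0 < g i) :
    ∃ r, 0 < r ∧ ∀ i, r ≤ g i := by
  cases isEmpty_or_nonempty ι
  · exact ⟨1, one_pos, fun i => isEmptyElim i⟩
  · obtain ⟨i, hi⟩ := Finite.exists_min g
    exact ⟨g i, hg i, hi⟩

theorem Matrix.PosDef.exists_pos_mul_le {n : ℕ} {P : Matrix (Fin n) (Fin n) ℝ} (hP : P.PosDef) :
    ∃ r, 0 < r ∧ ∀ x : Fin n → ℝ, r * (x ⬝ᵥ x) ≤ x ⬝ᵥ P *ᵥ x := by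
  obtain ⟨r, hr, h⟩ := exists_pos_forall_le hP.eigenvalues_pos
  exact ⟨r, hr, fun x => le_quadForm hP.1 x fun k => Or.inl (h k)⟩

theorem quadForm_le_maxEigenvalue {n : ℕ} {P : Matrix (Fin n) (Fin n) ℝ} (hP : P.IsHermitian)
    (x : Fin n → ℝ) : x ⬝ᵥ P *ᵥ x ≤ maxEigenvalue P * (x ⬝ᵥ x) :=
  quadForm_le hP (fun k => le_csSup (Matrix.finite_real_spectrum (𝕜 := ℝ)).bddAbove
    (hP.eigenvalues_mem_spectrum_real k)) x

section Deriv

variable {m : Type*} [Fintype m] {u w : ℝ → m → ℝ} {u' w' : m → ℝ} {s : ℝ} {T : Set ℝ}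

theorem HasDerivWithinAt.dotProduct (hu : HasDerivWithinAt u u' T s)
    (hw : HasDerivWithinAt w w' T s) :
    HasDerivWithinAt (fun r => u r ⬝ᵥ w r) (u' ⬝ᵥ w s + u s ⬝ᵥ w') T s := by
  refine (HasDerivWithinAt.fun_sum (u := Finset.univ) fun i _ =>
    (hasDerivWithinAt_pi.1 hu i).mul (hasDerivWithinAt_pi.1 hw i)).congr_deriv ?_
  rw [Finset.sum_add_distrib]
  rfl

theorem HasDerivWithinAt.matrix_mulVec (P : Matrix m m ℝ) (hu : HasDerivWithinAt u u' T s) :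
    HasDerivWithinAt (fun r => P *ᵥ u r) (P *ᵥ u') T s :=
  hasDerivWithinAt_pi.2 fun i => HasDerivWithinAt.fun_sum (u := Finset.univ) fun j _ =>
    (hasDerivWithinAt_pi.1 hu j).const_mul (P i j)

end Deriv

theorem two_mul_dotProduct_le {m : Type*} [Fintype m] (x y : m → ℝ) :
    2 * (x ⬝ᵥ y) ≤ x ⬝ᵥ x + y ⬝ᵥ y := by
  have := dotProduct_self_nonneg' (x - y)
  rw [sub_dotProduct, dotProduct_sub, dotProduct_sub, dotProduct_comm y x] at this
  linarith

/-- Dissipation of the Lyapunov function `x ↦ xᵀ P x` under a disturbance. -/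
theorem lyapunov_dissipation {n : ℕ} {A P : Matrix (Fin n) (Fin n) ℝ} (hP : P.PosDef)
    (hA : Aᵀ * P + P * A = (-2 : ℝ) • 1) (hmax : 0 < maxEigenvalue P) (x B X : Fin n → ℝ)
    (e ζ : ℝ) :
    (A *ᵥ x + e • B - ζ • X) ⬝ᵥ P *ᵥ x + x ⬝ᵥ P *ᵥ (A *ᵥ x + e • B - ζ • X)
      ≤ -(1 / maxEigenvalue P) * (x ⬝ᵥ P *ᵥ x)
        + (2 * ((P *ᵥ B) ⬝ᵥ (P *ᵥ B)) * e ^ 2 + 2 * ((P *ᵥ X) ⬝ᵥ (P *ᵥ X)) * ζ ^ 2) := by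
  have hT : Pᵀ = P := by rw [← Matrix.conjTranspose_eq_transpose_of_trivial]; exact hP.1
  have hsymm : ∀ u w : Fin n → ℝ, u ⬝ᵥ P *ᵥ w = w ⬝ᵥ P *ᵥ u := fun u w => by
    rw [Matrix.dotProduct_mulVec, ← Matrix.mulVec_transpose, hT, dotProduct_comm]
  have h1 : x ⬝ᵥ P *ᵥ (A *ᵥ x) + x ⬝ᵥ P *ᵥ (A *ᵥ x) = -2 * (x ⬝ᵥ x) := by
    have := congrArg (fun Q => x ⬝ᵥ Q *ᵥ x) hA
    simp only [Matrix.add_mulVec, dotProduct_add, Matrix.smul_mulVec, Matrix.one_mulVec,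
      dotProduct_smul, smul_eq_mul] at this
    rw [← this, ← Matrix.mulVec_mulVec, ← Matrix.mulVec_mulVec]
    congr 1
    rw [Matrix.mulVec_transpose, dotProduct_comm x (_ ᵥ* _), ← Matrix.dotProduct_mulVec,
      hsymm, dotProduct_comm]
  set w := P *ᵥ (e • B - ζ • X) with hw
  -- Half of the `-2 |x|²` from the Lyapunov equation absorbs the disturbance; the other half yields
  -- the decay rate `1 / λ_P`.
  have h2 := two_mul_dotProduct_le x w
  have h3 : w ⬝ᵥ w ≤ 2 * ((P *ᵥ B) ⬝ᵥ (P *ᵥ B)) * e ^ 2 + 2 * ((P *ᵥ X) ⬝ᵥ (P *ᵥ X)) * ζ ^ 2 := by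
    have := dotProduct_self_nonneg' (e • (P *ᵥ B) + ζ • (P *ᵥ X))
    rw [hw, Matrix.mulVec_sub, Matrix.mulVec_smul, Matrix.mulVec_smul]
    simp only [sub_dotProduct, dotProduct_sub, add_dotProduct, dotProduct_add, smul_dotProduct,
      dotProduct_smul, smul_eq_mul] at this ⊢
    nlinarith
  have h4 : 1 / maxEigenvalue P * (x ⬝ᵥ P *ᵥ x) ≤ x ⬝ᵥ x := by
    rw [one_div, inv_mul_le_iff₀ hmax]
    exact quadForm_le_maxEigenvalue hP.1 x
  have h5 : (A *ᵥ x + e • B - ζ • X) ⬝ᵥ P *ᵥ x = x ⬝ᵥ P *ᵥ (A *ᵥ x + e • B - ζ • X) := hsymm _ _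
  have h6 : x ⬝ᵥ P *ᵥ (A *ᵥ x + e • B - ζ • X) = x ⬝ᵥ P *ᵥ (A *ᵥ x) + x ⬝ᵥ w := by
    rw [add_sub_assoc, Matrix.mulVec_add, dotProduct_add]
  rw [h5, h6]
  linarith

/-- A Hurwitz system driven by a disturbance that decays to a bounded residual: the state decays
to a residual which is proportional to that of the disturbance along `B`. -/
theorem exists_tracking_bound {n : ℕ} {A P : Matrix (Fin n) (Fin n) ℝ} (hP : P.PosDef)
    (hA : Aᵀ * P + P * A = (-2 : ℝ) • 1) {γ : ℝ} (hγ_pos : 0 < γ)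
    (hγ : γ < 1 / (2 * maxEigenvalue P)) (B X : Fin n → ℝ) :
    ∃ κ : ℝ, 0 ≤ κ ∧ ∀ (c₀ c₁ M : ℝ) (ξ₀ : Fin n → ℝ), 0 ≤ c₀ → 0 ≤ c₁ → 0 ≤ M →
      ∃ M' : ℝ, 0 ≤ M' ∧ ∀ (b : ℝ) (ξ : ℝ → Fin n → ℝ), ξ 0 = ξ₀ → ContinuousOn ξ (Icc 0 b) →
        (∀ s ∈ Ico 0 b, ∃ e ζ : ℝ, |e| ≤ c₀ + c₁ * Real.exp (-γ * s) ∧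
          |ζ| ≤ M * Real.exp (-γ * s) ∧
          HasDerivWithinAt ξ (A *ᵥ ξ s + e • B - ζ • X) (Ici s) s) →
        ∀ s ∈ Icc 0 b, ξ s ⬝ᵥ ξ s ≤ (κ * c₀ + M' * Real.exp (-γ * s)) ^ 2 := by
  -- Division by zero gives `0`, so the bounds on `γ` already exclude a zero supremum, as for an
  -- empty spectrum.
  have hmax : 0 < maxEigenvalue P := by
    have h := one_div_pos.1 (hγ_pos.trans hγ)
    linarith
  set lP := maxEigenvalue P with hlP
  have hδ : 0 < 1 / lP - 2 * γ := by
    have : 1 / (2 * lP) = 1 / lP / 2 := by field_simp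
    linarith
  obtain ⟨pm, hpm, hpmle⟩ := hP.exists_pos_mul_le
  set b₁ := (P *ᵥ B) ⬝ᵥ (P *ᵥ B) with hb₁
  set b₂ := (P *ᵥ X) ⬝ᵥ (P *ᵥ X) with hb₂
  have hb₁0 : 0 ≤ b₁ := dotProduct_self_nonneg' _
  have hb₂0 : 0 ≤ b₂ := dotProduct_self_nonneg' _
  refine ⟨Real.sqrt (4 * b₁ * lP / pm), Real.sqrt_nonneg _, fun c₀ c₁ M ξ₀ hc₀ hc₁ hM => ?_⟩
  have hV₀ : 0 ≤ ξ₀ ⬝ᵥ P *ᵥ ξ₀ :=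
    (mul_nonneg hpm.le (dotProduct_self_nonneg' _)).trans (hpmle _)
  set F := 4 * b₁ * c₁ ^ 2 + 2 * b₂ * M ^ 2 with hF
  have hF0 : 0 ≤ F := by positivity
  -- `E` dominates the initial value and the forcing `F e^{-2γ s}`; the gap `1 / λ_P - 2γ > 0` is
  -- what the bound on `γ` provides.
  set E := ξ₀ ⬝ᵥ P *ᵥ ξ₀ + F / (1 / lP - 2 * γ) with hE
  have hE0 : 0 ≤ E := by positivity
  -- The residual is fixed before the horizon `b`, so it can be used before Zeno behavior is
  -- excluded.
  refine ⟨Real.sqrt (E / pm), Real.sqrt_nonneg _, fun b ξ h0 hcont hder s hs => ?_⟩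
  choose! e ζ he hζ hd using hder
  have hpm' : ContinuousOn (fun s => ξ s ⬝ᵥ P *ᵥ ξ s) (Icc 0 b) := by fun_prop
  have key := le_add_exp_of_deriv_right_le (δ := 1 / lP) (ρ := 2 * γ)
    (D := 4 * b₁ * lP * c₀ ^ 2) (E := E) hpm'
    (fun u hu => (hd u hu).dotProduct ((hd u hu).matrix_mulVec P))
    (fun u hu => by
      refine (lyapunov_dissipation hP hA hmax (ξ u) B X (e u) (ζ u)).trans ?_
      set ε := Real.exp (-γ * u) with hε
      have hε2 : Real.exp (-(2 * γ) * u) = ε ^ 2 := by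
        rw [hε, ← Real.exp_nat_mul]; congr 1; push_cast; ring
      have hε0 : 0 < ε := Real.exp_pos _
      have g1 : e u ^ 2 ≤ (c₀ + c₁ * ε) ^ 2 := by
        rw [← sq_abs]; exact pow_le_pow_left₀ (abs_nonneg _) (he u hu) 2
      have g2 : ζ u ^ 2 ≤ (M * ε) ^ 2 := by
        rw [← sq_abs]; exact pow_le_pow_left₀ (abs_nonneg _) (hζ u hu) 2
      have g3 : (c₀ + c₁ * ε) ^ 2 ≤ 2 * c₀ ^ 2 + 2 * (c₁ * ε) ^ 2 := by
        nlinarith [sq_nonneg (c₀ - c₁ * ε)]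
      have g4 : F ≤ (1 / lP - 2 * γ) * E := by
        rw [hE, mul_add, mul_div_cancel₀ _ hδ.ne']
        have := mul_nonneg hδ.le hV₀
        linarith
      have g5 : 1 / lP * (4 * b₁ * lP * c₀ ^ 2) = 4 * b₁ * c₀ ^ 2 := by field_simp
      have g6 : 2 * b₁ * e u ^ 2 ≤ 2 * b₁ * (2 * c₀ ^ 2 + 2 * (c₁ * ε) ^ 2) := by
        gcongr; exact g1.trans g3
      have g7 : 2 * b₂ * ζ u ^ 2 ≤ 2 * b₂ * (M * ε) ^ 2 := by gcongr
      have g8 : F * ε ^ 2 ≤ (1 / lP - 2 * γ) * E * ε ^ 2 := by gcongr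
      rw [hε2, g5]
      rw [hF] at g8
      linarith)
    (by
      rw [h0]
      have : 0 ≤ F / (1 / lP - 2 * γ) := by positivity
      have : 0 ≤ 4 * b₁ * lP * c₀ ^ 2 := by positivity
      linarith) s hs
  have hε2 : Real.exp (-(2 * γ) * s) = Real.exp (-γ * s) ^ 2 := by
    rw [← Real.exp_nat_mul]; congr 1; push_cast; ring
  rw [hε2] at key
  set ε := Real.exp (-γ * s)
  have hε0 : 0 < ε := Real.exp_pos _
  have k1 : ξ s ⬝ᵥ ξ s ≤ 4 * b₁ * lP / pm * c₀ ^ 2 + E / pm * ε ^ 2 := by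
    have : ξ s ⬝ᵥ ξ s ≤ (4 * b₁ * lP * c₀ ^ 2 + E * ε ^ 2) / pm := by
      rw [le_div_iff₀ hpm, mul_comm]; exact (hpmle _).trans key
    refine this.trans (le_of_eq ?_)
    field_simp
  have k2 := Real.sq_sqrt (show 0 ≤ 4 * b₁ * lP / pm by positivity)
  have k3 := Real.sq_sqrt (show 0 ≤ E / pm by positivity)
  have k4 : 0 ≤ Real.sqrt (4 * b₁ * lP / pm) * c₀ * (Real.sqrt (E / pm) * ε) := by positivity
  calc ξ s ⬝ᵥ ξ s ≤ 4 * b₁ * lP / pm * c₀ ^ 2 + E / pm * ε ^ 2 := k1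
    _ = (Real.sqrt (4 * b₁ * lP / pm) * c₀) ^ 2 + (Real.sqrt (E / pm) * ε) ^ 2 := by
      rw [mul_pow, mul_pow, k2, k3]
    _ ≤ _ := by linarith [add_sq (Real.sqrt (4 * b₁ * lP / pm) * c₀) (Real.sqrt (E / pm) * ε)]

theorem abs_dotProduct_le {m : Type*} [Fintype m] {r ξ : m → ℝ} {R : ℝ} (hR : 0 ≤ R)
    (h : ξ ⬝ᵥ ξ ≤ R ^ 2) : |r ⬝ᵥ ξ| ≤ Real.sqrt (r ⬝ᵥ r) * R := by
  refine abs_le_of_sq_le_sq ?_ (by positivity)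
  rw [mul_pow, Real.sq_sqrt (dotProduct_self_nonneg' _)]
  exact (dotProduct_sq_le _ _).trans (mul_le_mul_of_nonneg_left h (dotProduct_self_nonneg' _))

/-! ### A single event-triggered agent -/

/-- The trajectories of one agent under event-triggered tracking of a reference `z` whose velocity
is `ζ`. -/
structure IsAgentTrajectory {n : ℕ} (S : LinSys n) (K₁ : Fin n → ℝ) (K₂ c₀ c₁ γ : ℝ)
    (x : ℝ → Fin n → ℝ) (z ζ : ℝ → ℝ) (t : ℕ → ℝ≥0∞) : Prop where
  z_deriv : ∀ s : ℝ, 0 ≤ s → HasDerivWithinAt z (ζ s) (Ici 0) s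
  t_zero : t 0 = 0
  t_lt : ∀ k, t k ≠ ⊤ → t k < t (k + 1)
  t_succ : ∀ k, t (k + 1) = sInf {s : ℝ≥0∞ | t k < s ∧ s ≠ ⊤ ∧
    c₀ + c₁ * Real.exp (-γ * s.toReal) ≤
      |idealInput K₁ K₂ x z (t k).toReal - idealInput K₁ K₂ x z s.toReal|}
  x_cont : ContinuousOn x {s : ℝ | 0 ≤ s ∧ ∃ k, ENNReal.ofReal s < t k}
  x_deriv : ∀ k, ∀ s : ℝ, 0 ≤ s → t k ≤ ENNReal.ofReal s → ENNReal.ofReal s < t (k + 1) →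
    HasDerivWithinAt x
      (S.A *ᵥ x s + idealInput K₁ K₂ x z (t k).toReal • S.B) (Ici s) s

namespace IsAgentTrajectory

variable {n : ℕ} {S : LinSys n} {K₁ X : Fin n → ℝ} {U K₂ c₀ c₁ γ : ℝ}
  {P : Matrix (Fin n) (Fin n) ℝ} {x : ℝ → Fin n → ℝ} {z ζ : ℝ → ℝ} {t : ℕ → ℝ≥0∞}

theorem exists_interval (h : IsAgentTrajectory S K₁ K₂ c₀ c₁ γ x z ζ t) {s : ℝ}
    (hs : ∃ k, ENNReal.ofReal s < t k) :
    ∃ k, t k ≤ ENNReal.ofReal s ∧ ENNReal.ofReal s < t (k + 1) := by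
  classical
  have h1 := Nat.find_spec hs
  obtain ⟨k, hk⟩ : ∃ k, Nat.find hs = k + 1 := Nat.exists_eq_succ_of_ne_zero fun h0 => by
    rw [h0, h.t_zero] at h1
    exact not_lt_zero h1
  refine ⟨k, not_lt.1 (Nat.find_min hs (by omega)), ?_⟩
  rwa [hk] at h1

theorem abs_input_error_le (h : IsAgentTrajectory S K₁ K₂ c₀ c₁ γ x z ζ t) (hc₀ : 0 ≤ c₀)
    (hc₁ : 0 ≤ c₁) {k : ℕ} {s : ℝ} (hs : 0 ≤ s) (h1 : t k ≤ ENNReal.ofReal s)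
    (h2 : ENNReal.ofReal s < t (k + 1)) :
    |idealInput K₁ K₂ x z (t k).toReal - idealInput K₁ K₂ x z s| ≤
      c₀ + c₁ * Real.exp (-γ * s) := by
  rcases h1.eq_or_lt with heq | hlt
  · rw [heq, ENNReal.toReal_ofReal hs, sub_self, abs_zero]
    positivity
  · by_contra! hc
    rw [h.t_succ] at h2
    refine absurd (sInf_le ?_) (not_le.2 h2)
    refine ⟨hlt, ENNReal.ofReal_ne_top, ?_⟩
    rw [ENNReal.toReal_ofReal hs]
    exact hc.le

/-- The equation of the tracking error `x - z X`. -/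
theorem tracking_error_deriv
    (h : IsAgentTrajectory S K₁ (U - K₁ ⬝ᵥ X) c₀ c₁ γ x z ζ t)
    (hd : IsTrackingDesign S K₁ X U P) {k : ℕ} {s : ℝ} (hs : 0 ≤ s)
    (h1 : t k ≤ ENNReal.ofReal s) (h2 : ENNReal.ofReal s < t (k + 1)) :
    HasDerivWithinAt (fun r => x r - z r • X)
      (S.closedLoop K₁ *ᵥ (x s - z s • X) +
        (idealInput K₁ (U - K₁ ⬝ᵥ X) x z (t k).toReal - idealInput K₁ (U - K₁ ⬝ᵥ X) x z s) • S.B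
        - ζ s • X) (Ici s) s := by
  have hz := (h.z_deriv s hs).mono (Ici_subset_Ici.2 hs)
  refine ((h.x_deriv k s hs h1 h2).sub (hz.smul_const X)).congr_deriv ?_
  -- Since `K₂ = U - K₁ X`, the ideal input is `K₁ ξ + U z`, and `z (A X + U B)` vanishes.
  have hreg : S.A *ᵥ X = -(U • S.B) := eq_neg_of_add_eq_zero_left hd.regulator_state
  congr 1
  rw [LinSys.closedLoop, Matrix.add_mulVec, Matrix.mulVec_sub, Matrix.mulVec_smul, hreg,
    Matrix.vecMulVec_mulVec, dotProduct_sub, dotProduct_smul]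
  funext j
  simp only [idealInput, Pi.add_apply, Pi.sub_apply, Pi.smul_apply, Pi.neg_apply, smul_eq_mul,
    MulOpposite.smul_eq_mul_unop, MulOpposite.unop_op]
  ring

theorem z_continuousOn (h : IsAgentTrajectory S K₁ K₂ c₀ c₁ γ x z ζ t) :
    ContinuousOn z (Ici 0) := fun s hs => (h.z_deriv s hs).continuousWithinAt

theorem idealInput_continuousOn (h : IsAgentTrajectory S K₁ K₂ c₀ c₁ γ x z ζ t) :
    ContinuousOn (idealInput K₁ K₂ x z) {s : ℝ | 0 ≤ s ∧ ∃ k, ENNReal.ofReal s < t k} := by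
  have h1 := h.x_cont
  have h2 : ContinuousOn z {s : ℝ | 0 ≤ s ∧ ∃ k, ENNReal.ofReal s < t k} :=
    h.z_continuousOn.mono fun s hs => hs.1
  have h3 : ContinuousOn (fun s => K₁ ⬝ᵥ x s) {s : ℝ | 0 ≤ s ∧ ∃ k, ENNReal.ofReal s < t k} := by
    fun_prop
  exact h3.add (continuousOn_const.mul h2)

/-- The threshold is reached at every event. -/
theorem threshold_le_at_event (h : IsAgentTrajectory S K₁ K₂ c₀ c₁ γ x z ζ t) {k : ℕ}
    (hk : t (k + 1) ≠ ⊤) :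
    c₀ + c₁ * Real.exp (-γ * (t (k + 1)).toReal) ≤
      |idealInput K₁ K₂ x z (t k).toReal - idealInput K₁ K₂ x z (t (k + 1)).toReal| := by
  set T := {s : ℝ≥0∞ | t k < s ∧ s ≠ ⊤ ∧ c₀ + c₁ * Real.exp (-γ * s.toReal) ≤
      |idealInput K₁ K₂ x z (t k).toReal - idealInput K₁ K₂ x z s.toReal|} with hT
  have hsucc : t (k + 1) = sInf T := h.t_succ k
  have hne : T.Nonempty := by
    by_contra hemp
    rw [not_nonempty_iff_eq_empty] at hemp
    rw [hsucc, hemp, sInf_empty] at hk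
    exact hk rfl
  -- The infimum is a limit of times satisfying the trigger. Continuity is available only before
  -- later events, so these times are restricted to those before `t (k + 2)`, which is strictly
  -- beyond `t (k + 1)`.
  have hcl : t (k + 1) ∈ closure (Iio (t (k + 2)) ∩ T) := by
    have := csInf_mem_closure hne (OrderBot.bddBelow T)
    rw [← hsucc] at this
    exact isOpen_Iio.inter_closure ⟨h.t_lt (k + 1) hk, this⟩
  have := mem_closure_iff_nhdsWithin_neBot.1 hcl
  have htr : Tendsto ENNReal.toReal (𝓝[Iio (t (k + 2)) ∩ T] t (k + 1))
      (𝓝[{s : ℝ | 0 ≤ s ∧ ∃ k, ENNReal.ofReal s < t k}] (t (k + 1)).toReal) := by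
    refine tendsto_nhdsWithin_iff.2 ⟨(ENNReal.tendsto_toReal hk).mono_left nhdsWithin_le_nhds, ?_⟩
    filter_upwards [self_mem_nhdsWithin] with u hu
    refine ⟨ENNReal.toReal_nonneg, k + 2, ?_⟩
    rw [ENNReal.ofReal_toReal hu.2.2.1]
    exact hu.1
  have hin := (h.idealInput_continuousOn (t (k + 1)).toReal ⟨ENNReal.toReal_nonneg, k + 2, by
    rw [ENNReal.ofReal_toReal hk]; exact h.t_lt (k + 1) hk⟩).tendsto.comp htr
  have hexp : Tendsto (fun u : ℝ≥0∞ => c₀ + c₁ * Real.exp (-γ * u.toReal))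
      (𝓝[Iio (t (k + 2)) ∩ T] t (k + 1)) (𝓝 (c₀ + c₁ * Real.exp (-γ * (t (k + 1)).toReal))) := by
    have hcont : Continuous fun r : ℝ => c₀ + c₁ * Real.exp (-γ * r) := by fun_prop
    exact (hcont.tendsto _).comp (htr.mono_right nhdsWithin_le_nhds)
  refine le_of_tendsto_of_tendsto hexp (tendsto_const_nhds.sub hin).abs ?_
  filter_upwards [self_mem_nhdsWithin] with u hu
  exact hu.2.2.2

/-- A uniform gap gives `t k ≥ k τ`, so the bounds valid before the accumulation of events become
global in time. -/
theorem lt_of_gap (h : IsAgentTrajectory S K₁ K₂ c₀ c₁ γ x z ζ t) {τ : ℝ} (hτ : 0 < τ)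
    (hgap : ∀ k, t k ≠ ⊤ → t k + ENNReal.ofReal τ < t (k + 1)) (s : ℝ) :
    ∃ k, ENNReal.ofReal s < t k := by
  have hle : ∀ k : ℕ, ENNReal.ofReal (k * τ) ≤ t k := by
    intro k
    induction k with
    | zero => simp
    | succ k ih =>
      by_cases hk : t k = ⊤
      · have : t (k + 1) = ⊤ := by
          rw [h.t_succ, hk]
          simp
        rw [this]
        exact le_top
      · push_cast
        rw [add_mul, one_mul, ENNReal.ofReal_add (by positivity) hτ.le]
        exact (add_le_add_left ih _).trans (hgap k hk).le
  obtain ⟨k, hk⟩ := exists_nat_gt (s / τ)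
  have hk0 : s < k * τ := (div_lt_iff₀ hτ).1 hk
  by_cases hs : 0 ≤ s
  · exact ⟨k, ((ENNReal.ofReal_lt_ofReal_iff (hs.trans_lt hk0)).2 hk0).trans_le (hle k)⟩
  · refine ⟨1, ?_⟩
    rw [ENNReal.ofReal_of_nonpos (by linarith)]
    refine lt_of_le_of_lt zero_le (h.t_lt 0 ?_)
    rw [h.t_zero]; exact ENNReal.zero_ne_top

end IsAgentTrajectory

/-- Event-triggered tracking: the inter-event times are bounded below, and the output tracks the
reference up to a residual which is proportional to `c₀`. -/
theorem exists_agent_tracking {n : ℕ} {S : LinSys n} {K₁ X : Fin n → ℝ} {U γ : ℝ}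
    {P : Matrix (Fin n) (Fin n) ℝ} (hd : IsTrackingDesign S K₁ X U P) (hγ_pos : 0 < γ)
    (hγ : γ < 1 / (2 * maxEigenvalue P)) :
    ∃ κ : ℝ, 0 ≤ κ ∧ ∀ c₀ c₁ M : ℝ, 0 ≤ c₀ → 0 ≤ c₁ → 0 < c₀ + c₁ → 0 ≤ M →
      ∀ (x : ℝ → Fin n → ℝ) (z ζ : ℝ → ℝ) (t : ℕ → ℝ≥0∞),
        IsAgentTrajectory S K₁ (U - K₁ ⬝ᵥ X) c₀ c₁ γ x z ζ t →
        (∀ s : ℝ, 0 ≤ s → |ζ s| ≤ M * Real.exp (-γ * s)) →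
        (∃ τ : ℝ, 0 < τ ∧ ∀ k, t k ≠ ⊤ → t k + ENNReal.ofReal τ < t (k + 1)) ∧
        ∃ M' : ℝ, 0 ≤ M' ∧ ∀ s : ℝ, 0 ≤ s →
          |S.C ⬝ᵥ x s - z s| ≤ κ * c₀ + M' * Real.exp (-γ * s) := by
  obtain ⟨κ, hκ, hbound⟩ := exists_tracking_bound hd.posDef hd.lyapunov hγ_pos hγ S.B X
  refine ⟨Real.sqrt (S.C ⬝ᵥ S.C) * κ, by positivity,
    fun c₀ c₁ M hc₀ hc₁ hc hM x z ζ t h hζ => ?_⟩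
  obtain ⟨M', hM', hξ⟩ := hbound c₀ c₁ M (x 0 - z 0 • X) hc₀ hc₁ hM
  set K₂ := U - K₁ ⬝ᵥ X with hK₂
  -- the bound holds as long as events do not accumulate
  have hξ' : ∀ s : ℝ, 0 ≤ s → (∃ k, ENNReal.ofReal s < t k) →
      (x s - z s • X) ⬝ᵥ (x s - z s • X) ≤ (κ * c₀ + M' * Real.exp (-γ * s)) ^ 2 := by
    rintro s hs ⟨m, hm⟩
    have hlt : ∀ u ≤ s, ∃ k, ENNReal.ofReal u < t k := fun u hu =>
      ⟨m, (ENNReal.ofReal_le_ofReal hu).trans_lt hm⟩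
    refine hξ s (fun r => x r - z r • X) rfl ?_ ?_ s ⟨hs, le_rfl⟩
    · have h1 := h.x_cont.mono (s := _) (t := Icc 0 s) fun u hu => ⟨hu.1, hlt u hu.2⟩
      have h2 := h.z_continuousOn.mono (t := Icc 0 s) fun u hu => hu.1
      exact h1.sub (h2.smul continuousOn_const)
    · intro u hu
      obtain ⟨k, hk1, hk2⟩ := h.exists_interval (hlt u hu.2.le)
      exact ⟨_, ζ u, h.abs_input_error_le hc₀ hc₁ hu.1 hk1 hk2, hζ u hu.1,
        h.tracking_error_deriv hd hu.1 hk1 hk2⟩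
  -- growth of the input error
  set R₁ := Real.sqrt ((K₁ ᵥ* S.closedLoop K₁) ⬝ᵥ (K₁ ᵥ* S.closedLoop K₁)) with hR₁
  -- `Q` bounds the slope of the ideal input relative to the threshold `c₀ + c₁ ε` at the last
  -- event, where `ε = e^{-γ t_k}`. The division reflects `ε ≤ (c₀ + c₁ ε) / (c₀ + c₁)`, valid as `ε
  -- ≤ 1`.
  set Q := R₁ * κ + |K₁ ⬝ᵥ S.B| + (R₁ * M' + |K₂| * M) / (c₀ + c₁) with hQ
  have hQ0 : 0 ≤ Q := by positivity
  have hgap : ∃ τ : ℝ, 0 < τ ∧ ∀ k, t k ≠ ⊤ → t k + ENNReal.ofReal τ < t (k + 1) := by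
    -- Within time `τ ≤ 1` the threshold shrinks at most by the factor `e^{-γ}`, while the error
    -- grows at most to `Q τ < e^{-γ}` times the initial threshold.
    set τ := Real.exp (-γ) / (Q + 1) with hτ
    have hτ0 : 0 < τ := by positivity
    have hτ1 : τ ≤ 1 := by
      rw [hτ, div_le_one (by positivity)]
      have : Real.exp (-γ) ≤ 1 := Real.exp_le_one_iff.2 (by linarith)
      linarith
    refine ⟨τ, hτ0, fun k hk => ?_⟩
    by_contra! hle
    have hk1 : t (k + 1) ≠ ⊤ :=
      ne_top_of_le_ne_top (ENNReal.add_ne_top.2 ⟨hk, ENNReal.ofReal_ne_top⟩) hle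
    set s₀ := (t k).toReal with hs₀
    set s₁ := (t (k + 1)).toReal with hs₁
    have hs₀0 : 0 ≤ s₀ := ENNReal.toReal_nonneg
    have e₀ : ENNReal.ofReal s₀ = t k := ENNReal.ofReal_toReal hk
    have e₁ : ENNReal.ofReal s₁ = t (k + 1) := ENNReal.ofReal_toReal hk1
    have hs01 : s₀ < s₁ := (ENNReal.toReal_lt_toReal hk hk1).2 (h.t_lt k hk)
    have hs10 : s₁ - s₀ ≤ τ := by
      have := ENNReal.toReal_mono (ENNReal.add_ne_top.2 ⟨hk, ENNReal.ofReal_ne_top⟩) hle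
      rw [ENNReal.toReal_add hk ENNReal.ofReal_ne_top, ENNReal.toReal_ofReal hτ0.le] at this
      linarith
    set ε := Real.exp (-γ * s₀) with hε
    have hε0 : 0 < ε := Real.exp_pos _
    have hmono : ∀ u, s₀ ≤ u → Real.exp (-γ * u) ≤ ε := fun u hu =>
      Real.exp_le_exp.2 (by nlinarith)
    have hε1 : ε ≤ 1 := Real.exp_le_one_iff.2 (by nlinarith)
    have hεc : ε ≤ (c₀ + c₁ * ε) / (c₀ + c₁) := by
      rw [le_div_iff₀ hc]
      nlinarith
    have hslope := norm_image_sub_le_of_norm_deriv_right_le_segment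
      (f := idealInput K₁ K₂ x z) (a := s₀) (b := s₁) (C := Q * (c₀ + c₁ * ε))
      (f' := fun u => K₁ ⬝ᵥ (S.closedLoop K₁ *ᵥ (x u - z u • X) +
        (idealInput K₁ K₂ x z s₀ - idealInput K₁ K₂ x z u) • S.B) + K₂ * ζ u)
      (h.idealInput_continuousOn.mono fun u hu => ⟨hs₀0.trans hu.1, k + 2,
        (ENNReal.ofReal_le_ofReal hu.2).trans_lt (e₁ ▸ h.t_lt (k + 1) hk1)⟩)
      (fun u hu => by
        have hu0 : 0 ≤ u := hs₀0.trans hu.1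
        have hk_1 : t k ≤ ENNReal.ofReal u := e₀ ▸ ENNReal.ofReal_le_ofReal hu.1
        have hk_2 : ENNReal.ofReal u < t (k + 1) := by
          rw [← e₁]; exact (ENNReal.ofReal_lt_ofReal_iff (by linarith)).2 hu.2
        have hz := (h.z_deriv u hu0).mono (Ici_subset_Ici.2 hu0)
        have hx := (h.tracking_error_deriv hd hu0 hk_1 hk_2).add (hz.smul_const X)
        have hx' : HasDerivWithinAt x (S.closedLoop K₁ *ᵥ (x u - z u • X) +
            (idealInput K₁ K₂ x z s₀ - idealInput K₁ K₂ x z u) • S.B) (Ici u) u := by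
          refine (hx.congr_deriv (sub_add_cancel _ _)).congr (fun r _ => ?_) ?_ <;> simp
        have hK : HasDerivWithinAt (fun r => K₁ ⬝ᵥ x r) _ (Ici u) u :=
          HasDerivWithinAt.fun_sum (u := Finset.univ) fun j _ =>
            (hasDerivWithinAt_pi.1 hx' j).const_mul (K₁ j)
        exact hK.add (hz.const_mul K₂))
      (fun u hu => by
        have hu0 : 0 ≤ u := hs₀0.trans hu.1
        have hk_1 : t k ≤ ENNReal.ofReal u := e₀ ▸ ENNReal.ofReal_le_ofReal hu.1
        have hk_2 : ENNReal.ofReal u < t (k + 1) := by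
          rw [← e₁]; exact (ENNReal.ofReal_lt_ofReal_iff (by linarith)).2 hu.2
        have hεu := hmono u hu.1
        have hεu0 := Real.exp_pos (-γ * u)
        have b1 : |(K₁ ᵥ* S.closedLoop K₁) ⬝ᵥ (x u - z u • X)| ≤ R₁ * (κ * c₀ + M' * ε) :=
          (abs_dotProduct_le (by positivity) (hξ' u hu0 ⟨_, hk_2⟩)).trans (by gcongr)
        have b2 : |idealInput K₁ K₂ x z s₀ - idealInput K₁ K₂ x z u| ≤ c₀ + c₁ * ε :=
          (h.abs_input_error_le hc₀ hc₁ hu0 hk_1 hk_2).trans (by gcongr)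
        have b3 : |ζ u| ≤ M * ε := (hζ u hu0).trans (by gcongr)
        rw [Real.norm_eq_abs, dotProduct_add, dotProduct_smul, Matrix.dotProduct_mulVec,
          smul_eq_mul]
        calc _ ≤ R₁ * (κ * c₀ + M' * ε) + (c₀ + c₁ * ε) * |K₁ ⬝ᵥ S.B| + |K₂| * (M * ε) := by
              refine (abs_add_le _ _).trans (add_le_add ((abs_add_le _ _).trans
                (add_le_add b1 ?_)) ?_)
              · rw [abs_mul]; gcongr
              · rw [abs_mul]; gcongr
          _ = R₁ * κ * c₀ + |K₁ ⬝ᵥ S.B| * (c₀ + c₁ * ε) + (R₁ * M' + |K₂| * M) * ε := by ring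
          _ ≤ R₁ * κ * (c₀ + c₁ * ε) + |K₁ ⬝ᵥ S.B| * (c₀ + c₁ * ε)
              + (R₁ * M' + |K₂| * M) * ((c₀ + c₁ * ε) / (c₀ + c₁)) := by
              have : c₀ ≤ c₀ + c₁ * ε := by
                have : 0 ≤ c₁ * ε := by positivity
                linarith
              gcongr
          _ = Q * (c₀ + c₁ * ε) := by rw [hQ]; ring)
      s₁ ⟨hs01.le, le_rfl⟩
    have hthr := h.threshold_le_at_event hk1
    rw [Real.norm_eq_abs, abs_sub_comm] at hslope
    have hfin := hthr.trans hslope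
    have hpos : 0 < c₀ + c₁ * ε := by
      rcases hc₀.eq_or_lt with h0 | h0
      · have : 0 < c₁ := by linarith
        positivity
      · positivity
    have hexpτ : Real.exp (-γ) * (c₀ + c₁ * ε) ≤ c₀ + c₁ * Real.exp (-γ * s₁) := by
      have g1 : Real.exp (-γ) * ε ≤ Real.exp (-γ * s₁) := by
        rw [hε, ← Real.exp_add]
        exact Real.exp_le_exp.2 (by nlinarith)
      have g2 : Real.exp (-γ) ≤ 1 := Real.exp_le_one_iff.2 (by linarith)
      have g3 : c₁ * (Real.exp (-γ) * ε) ≤ c₁ * Real.exp (-γ * s₁) := by gcongr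
      nlinarith
    have hlast : Real.exp (-γ) * (c₀ + c₁ * ε) ≤ Q * τ * (c₀ + c₁ * ε) := by
      refine (hexpτ.trans hfin).trans ?_
      have : Q * (c₀ + c₁ * ε) * (s₁ - s₀) ≤ Q * (c₀ + c₁ * ε) * τ := by gcongr
      linarith
    have hcontra := le_of_mul_le_mul_right hlast hpos
    have hτQ : τ * (Q + 1) = Real.exp (-γ) := by rw [hτ]; field_simp
    nlinarith
  obtain ⟨τ, hτ0, hτ⟩ := hgap
  refine ⟨⟨τ, hτ0, hτ⟩, Real.sqrt (S.C ⬝ᵥ S.C) * M', by positivity, fun s hs => ?_⟩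
  have e : S.C ⬝ᵥ x s - z s = S.C ⬝ᵥ (x s - z s • X) := by
    rw [dotProduct_sub, dotProduct_smul, hd.regulator_output]; simp
  rw [e]
  refine (abs_dotProduct_le (by positivity) (hξ' s hs (h.lt_of_gap hτ0 hτ s))).trans
    (le_of_eq (by ring))

/-! ### Strongly convex costs with Lipschitz gradients -/

/-- By the mean value theorem, an increment of `f'` is a value of `f''` times the step. -/
theorem deriv_secant_bounds {f : ℝ → ℝ} {l u : ℝ} (hf : ContDiff ℝ 2 f) (hl : 0 < l)
    (hlo : ∀ s, l ≤ deriv (deriv f) s) (hhi : ∀ s, deriv (deriv f) s ≤ u) (r s : ℝ) :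
    l * (s - r) ^ 2 ≤ (s - r) * (deriv f s - deriv f r) ∧
      (deriv f s - deriv f r) ^ 2 ≤ u ^ 2 * (s - r) ^ 2 := by
  have hd : Differentiable ℝ (deriv f) :=
    (hf.iterate_deriv' 1 1).differentiable (by norm_num)
  obtain ⟨m, hm⟩ : ∃ m, deriv f s - deriv f r = deriv (deriv f) m * (s - r) := by
    rcases lt_trichotomy r s with h | h | h
    · obtain ⟨m, -, hm⟩ := exists_deriv_eq_slope (deriv f) h hd.continuous.continuousOn
        hd.differentiableOn
      exact ⟨m, by rw [hm, div_mul_cancel₀ _ (by linarith)]⟩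
    · exact ⟨r, by simp [h]⟩
    · obtain ⟨m, -, hm⟩ := exists_deriv_eq_slope (deriv f) h hd.continuous.continuousOn
        hd.differentiableOn
      refine ⟨m, ?_⟩
      have : r - s ≠ 0 := by linarith
      rw [hm]
      field_simp
      ring
  have h1 := hlo m
  have h2 := hhi m
  rw [hm]
  constructor
  · nlinarith [sq_nonneg (s - r)]
  · rw [mul_pow]
    have : deriv (deriv f) m ^ 2 ≤ u ^ 2 := pow_le_pow_left₀ (hl.le.trans h1) h2 2
    gcongr

theorem sum_deriv_eq_zero_of_forall_le {ι : Type*} [Fintype ι] {f : ι → ℝ → ℝ}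
    (hf : ∀ i, Differentiable ℝ (f i)) {r : ℝ} (hr : ∀ s, ∑ i, f i r ≤ ∑ i, f i s) :
    ∑ i, deriv (f i) r = 0 := by
  have hmin : IsLocalMin (fun s => ∑ i, f i s) r := Eventually.of_forall hr
  exact hmin.hasDerivAt_eq_zero (HasDerivAt.fun_sum fun i _ => (hf i r).hasDerivAt)

theorem infDist_Icc_le {r c κ ε : ℝ} (hκ : 0 ≤ κ) (hε : 0 ≤ ε) (h : |r - c| ≤ κ + ε) :
    Metric.infDist r (Icc (c - κ) (c + κ)) ≤ ε := by
  obtain ⟨h1, h2⟩ := abs_le.1 h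
  -- The witness is the projection of `r` onto the interval.
  have hmem : max (c - κ) (min r (c + κ)) ∈ Icc (c - κ) (c + κ) :=
    ⟨le_max_left _ _, max_le (by linarith) (min_le_right _ _)⟩
  refine (Metric.infDist_le_dist_of_mem hmem).trans ?_
  rw [Real.dist_eq, abs_le]
  constructor
  · have : max (c - κ) (min r (c + κ)) ≤ r + ε :=
      max_le (by linarith) ((min_le_left _ _).trans (by linarith))
    linarith
  · have : r - ε ≤ max (c - κ) (min r (c + κ)) :=
      (le_min (by linarith) (by linarith)).trans (le_max_right _ _)
    linarith

/-! ### The closed loop -/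

theorem corollary1 {N : ℕ} (hN : 2 ≤ N)
    -- the agents
    (n : Fin N → ℕ) (S : ∀ i, LinSys (n i))
    (hmin : ∀ i, (S i).IsMinimal) (hzero : ∀ i, (S i).NoTransmissionZeroAtOrigin)
    -- the cost functions and the minimizer of their sum
    (f : Fin N → ℝ → ℝ) (hlo hhi : Fin N → ℝ)
    (hf : ∀ i, ContDiff ℝ 2 (f i)) (hlo_pos : ∀ i, 0 < hlo i) (hlo_le : ∀ i, hlo i ≤ hhi i)
    (hf_lo : ∀ i s, hlo i ≤ deriv (deriv (f i)) s) (hf_hi : ∀ i s, deriv (deriv (f i)) s ≤ hhi i)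
    (ystar : ℝ) (hystar : ∀ s, ∑ i, f i ystar ≤ ∑ i, f i s)
    -- the communication digraph
    (a : Matrix (Fin N) (Fin N) ℝ) (ha : ∀ i j, 0 ≤ a i j)
    (hconn : IsStronglyConnected a) (hbal : IsWeightBalanced a)
    -- the tracking controllers
    (K₁ X : ∀ i, Fin (n i) → ℝ) (U : Fin N → ℝ) (P : ∀ i, Matrix (Fin (n i)) (Fin (n i)) ℝ)
    (hdesign : ∀ i, IsTrackingDesign (S i) (K₁ i) (X i) (U i) (P i))
    -- the parameters
    (η α β γ : ℝ) (hη : 0 < η)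
    (hα : max 1 (max (2 * η / min (⨅ i, hlo i) (lambdaTwo hN a))
      (6 * (⨆ i, hhi i) ^ 2 / ((⨅ i, hlo i) * lambdaTwo hN a))) ≤ α)
    (hβ : max 1 (7 * α ^ 2 * lambdaMax hN a ^ 2 / lambdaTwo hN a ^ 2) ≤ β)
    (hγ_pos : 0 < γ) (hγ : ∀ i, γ < min 1 (min (1 / (2 * maxEigenvalue (P i))) η)) :
    ∃ κ : ℝ, 0 < κ ∧ ∃ μ : ℝ, 0 < μ ∧
      ∀ c₀ c₁ : ℝ, 0 ≤ c₀ → 0 ≤ c₁ → 0 < c₀ + c₁ →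
      ∀ (x : ∀ i, ℝ → Fin (n i) → ℝ) (z v : Fin N → ℝ → ℝ) (t : Fin N → ℕ → ℝ≥0∞),
        IsTrajectory S K₁ (fun i => U i - K₁ i ⬝ᵥ X i) f a α β c₀ c₁ γ x z v t →
        -- the inter-event times are uniformly bounded below
        (∃ τ : ℝ, 0 < τ ∧ ∀ i k, t i k ≠ ⊤ → t i k + ENNReal.ofReal τ < t i (k + 1)) ∧
        -- the outputs converge into an interval around `ystar` of radius proportional to `c₀`
        (∀ i, Tendsto (fun s : ℝ => Metric.infDist ((S i).C ⬝ᵥ x i s)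
          (Icc (ystar - κ * c₀) (ystar + κ * c₀))) atTop (𝓝 0)) ∧
        -- if `c₀ = 0`, they converge to `ystar` exponentially
        (c₀ = 0 → ∃ M : ℝ, ∀ i, ∀ s : ℝ, 0 ≤ s →
          |(S i).C ⬝ᵥ x i s - ystar| ≤ M * Real.exp (-μ * s)) := by
  have hne : Nonempty (Fin N) := ⟨⟨0, by omega⟩⟩
  have hl₂ := lambdaTwo_pos hN ha hbal hconn
  set l := ⨅ i, hlo i with hl_def
  set u := ⨆ i, hhi i with hu_def
  have hl : 0 < l := by
    obtain ⟨i, hi⟩ := exists_eq_ciInf_of_finite (f := hlo)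
    rw [hl_def, ← hi]
    exact hlo_pos i
  have hl_le : ∀ i, l ≤ hlo i := fun i => ciInf_le (Set.finite_range hlo).bddBelow i
  have hu_ge : ∀ i, hhi i ≤ u := fun i => le_ciSup (Set.finite_range hhi).bddAbove i
  obtain ⟨hα1, hα2, hα3⟩ : 1 ≤ α ∧ 2 * η / min l (lambdaTwo hN a) ≤ α ∧
      6 * u ^ 2 / (l * lambdaTwo hN a) ≤ α := by
    simpa only [max_le_iff] using hα
  have hα0 : 0 < α := by linarith
  have hmin_pos : 0 < min l (lambdaTwo hN a) := lt_min hl hl₂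
  rw [div_le_iff₀ hmin_pos] at hα2
  rw [div_le_iff₀ (mul_pos hl hl₂)] at hα3
  have hβ2 := (max_le_iff.1 hβ).2
  rw [div_le_iff₀ (by positivity)] at hβ2
  have hγη : γ < η := (hγ hne.some).trans_le ((min_le_right _ _).trans (min_le_right _ _))
  have hγP : ∀ i, γ < 1 / (2 * maxEigenvalue (P i)) := fun i =>
    (hγ i).trans_le ((min_le_right _ _).trans (min_le_left _ _))
  choose κ hκ hagent using fun i => exists_agent_tracking (hdesign i) hγ_pos (hγP i)
  -- The sum serves all agents at once, and the `1` ensures positivity, as each `κ i` may vanish.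
  -- The rate `μ` is `γ`, the slowest one in the cascade.
  refine ⟨1 + ∑ i, κ i, by
    have : 0 ≤ ∑ i, κ i := Finset.sum_nonneg fun i _ => hκ i
    linarith, γ, hγ_pos, fun c₀ c₁ hc₀ hc₁ hc x z v t htraj => ?_⟩
  have hsec : ∀ i s, _ := fun i s => deriv_secant_bounds (hf i) hl
    (fun s => (hl_le i).trans (hf_lo i s)) (fun s => (hf_hi i s).trans (hu_ge i)) ystar s
  obtain ⟨M, hM, hopt⟩ := optimizer_convergence (φ := fun i => deriv (f i)) (ystar := ystar)
    (hl := l) (hb := u) (η := η) hN ha hbal hconn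
    (fun i s => (hsec i s).1) (fun i s => (hsec i s).2)
    (sum_deriv_eq_zero_of_forall_le (fun i => (hf i).differentiable (by norm_num)) hystar)
    hα1 hl (hα2.trans (by gcongr; exact min_le_left _ _))
    (hα2.trans (by gcongr; exact min_le_right _ _)) hα3 hβ2 htraj.z_deriv htraj.v_deriv
  have hexp : ∀ s : ℝ, 0 ≤ s → M * Real.exp (-η * s) ≤ M * Real.exp (-γ * s) := fun s hs => by
    have : -η * s ≤ -γ * s := by nlinarith
    gcongr
  have hres := fun i => hagent i c₀ c₁ M hc₀ hc₁ hc hM (x i) (z i)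
    (optimizerRate a (fun i => deriv (f i)) α β z v i) (t i)
    ⟨htraj.z_deriv i, htraj.t_zero i, htraj.t_lt i, htraj.t_succ i, htraj.x_cont i,
      htraj.x_deriv i⟩ (fun s hs => ((hopt i s hs).2).trans (hexp s hs))
  choose hgap M' hM' hout using hres
  choose τ hτ hτgap using hgap
  set R := M + ∑ i, M' i with hR
  have hR0 : 0 ≤ R := add_nonneg hM (Finset.sum_nonneg fun i _ => hM' i)
  have hy : ∀ i, ∀ s : ℝ, 0 ≤ s → |(S i).C ⬝ᵥ x i s - ystar| ≤
      (1 + ∑ i, κ i) * c₀ + R * Real.exp (-γ * s) := fun i s hs => by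
    have e1 : κ i ≤ 1 + ∑ i, κ i := by
      have := Finset.single_le_sum (f := κ) (fun i _ => hκ i) (Finset.mem_univ i)
      linarith
    have e2 : M' i ≤ ∑ i, M' i :=
      Finset.single_le_sum (f := M') (fun i _ => hM' i) (Finset.mem_univ i)
    have e3 : κ i * c₀ ≤ (1 + ∑ i, κ i) * c₀ := by gcongr
    have e4 : M' i * Real.exp (-γ * s) ≤ (∑ i, M' i) * Real.exp (-γ * s) := by gcongr
    have e5 := abs_sub_le ((S i).C ⬝ᵥ x i s) (z i s) ystar
    have e6 := hout i s hs
    have e7 := ((hopt i s hs).1).trans (hexp s hs)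
    rw [hR, add_mul]
    linarith
  refine ⟨?_, fun i => ?_, fun h0 => ⟨R, fun i s hs => ?_⟩⟩
  · obtain ⟨r, hr, hrle⟩ := exists_pos_forall_le hτ
    exact ⟨r, hr, fun i k hk => lt_of_le_of_lt
      (add_le_add_right (ENNReal.ofReal_le_ofReal (hrle i)) _) (hτgap i k hk)⟩
  · have hlim : Tendsto (fun s : ℝ => R * Real.exp (-γ * s)) atTop (𝓝 0) := by
      have h1 : Tendsto (fun s : ℝ => -γ * s) atTop atBot :=
        tendsto_id.const_mul_atTop_of_neg (by linarith)
      simpa using (Real.tendsto_exp_atBot.comp h1).const_mul R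
    refine squeeze_zero' (Eventually.of_forall fun s => Metric.infDist_nonneg) ?_ hlim
    filter_upwards [eventually_ge_atTop 0] with s hs
    refine infDist_Icc_le (mul_nonneg ?_ hc₀) (by positivity) (hy i s hs)
    have : 0 ≤ ∑ i, κ i := Finset.sum_nonneg fun i _ => hκ i
    linarith
  · have := hy i s hs
    rwa [h0, mul_zero, zero_add] at this
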